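/- Consider two families of polynomials $P_n(\eta;\lambda)$, $\lambda\in\mathbb{C}^4$, in a variable $\eta=\eta(x)$, $x\in\mathbb{C}$. Wilson (W): $\gamma=1$, $\eta(x)=x^2$, $\varphi(x)=2x$, $(a_1,\dots,a_4)=\lambda$, $b_1=a_1+a_2+a_3+a_4$, $\mathcal{E}_n(\lambda)=n(n+b_1-1)$, and $$P_n(\eta(x);\lambda)=(a_1+a_2)_n(a_1+a_3)_n(a_1+a_4)_n\;{}_4F_3\Bigl({-n,\;n+b_1-1,\;a_1+ix,\;a_1-ix\atop a_1+a_2,\;a_1+a_3,\;a_1+a_4}\Bigm|1\Bigr).$$ Askey-Wilson (AW): $0<q<1$, $\gamma=\log q$, $\eta(x)=\cos x$, $\varphi(x)=2\sin x$, $a_j=q^{\lambda_j}$, $b_4=a_1a_2a_3a_4$, $\mathcal{E}_n(\lambda)=(q^{-n}-1)(1-b_4q^{n-1})$, and $$P_n(\eta(x);\lambda)=a_1^{-n}(a_1a_2,a_1a_3,a_1a_4;q)_n\;{}_4\phi_3\Bigl({q^{-n},\;b_4q^{n-1},\;a_1e^{ix},\;a_1e^{-ix}\atop a_1a_2,\;a_1a_3,\;a_1a_4}\Bigm|q;q\Bigr).$$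 (In both cases the prefactor is multiplied into the terminating series, so that $P_n$ is defined for every $\lambda\in\mathbb{C}^4$.) For functions $f_1,\dots,f_n$ put $$\mathrm{W}_\gamma[f_1,\dots,f_n](x)=i^{\frac12n(n-1)}\det\bigl(f_k(x_j)\bigr)_{1\le j,k\le n},\qquad x_j=x+i\bigl(\tfrac{n+1}{2}-j\bigr)\gamma,$$ with $\mathrm{W}_\gamma[\,]=1$ for $n=0$, and put $$\varphi_M(x)=\varphi(x)^{\lfloor M/2\rfloor}\prod_{k=1}^{M-2}\bigl(\varphi(x-i\tfrac k2\gamma)\,\varphi(x+i\tfrac k2\gamma)\bigr)^{\lfloor (M-k)/2\rfloor}.$$ Let $\mathcal{D}=\{d_1,\dots,d_M\}$ be distinct non-negative integers, $N\ge d_j$ for all $j$, and $\bar{\mathcal{D}}=\{0,1,\dots,N\}\setminus\{N-d_1,\dots,N-d_M\}=\{e_1<\dots<e_{N+1-M}\}$. Let $\mathfrak{t}(\lambda)=(1-\lambda_1,\dots,1-\lambda_4)$, $\bar\lambda=\lambda-(N+1)(\tfrac12,\tfrac12,\tfrac12,\tfrac12)$, $\check\xi_v(x;\lambda)=P_v(\eta(x);\mathfrak{t}(\lambda))$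 and $\check P_n(x;\lambda)=P_n(\eta(x);\lambda)$. Then for every $\lambda\in\mathbb{C}^4$ there are polynomials $\Xi_{\mathcal{D}}$ and $\bar\Xi_{\bar{\mathcal{D}}}$ in $\eta$ such that for all $x\in\mathbb{C}$ $$\mathrm{W}_\gamma[\check\xi_{d_1},\dots,\check\xi_{d_M}](x;\lambda)=\varphi_M(x)\,\Xi_{\mathcal{D}}(\eta(x)),\qquad \mathrm{W}_\gamma[\check P_{e_1},\dots,\check P_{e_{N+1-M}}](x;\bar\lambda)=\varphi_{N+1-M}(x)\,\bar\Xi_{\bar{\mathcal{D}}}(\eta(x)),$$ and these two polynomials are linearly dependent: $c\,\Xi_{\mathcal{D}}=c'\,\bar\Xi_{\bar{\mathcal{D}}}$ for some constants $c,c'\in\mathbb{C}$, not both zero. Moreover, for generic $\lambda$, namely whenever $\mathcal{E}_0(\bar\lambda),\dots,\mathcal{E}_N(\bar\lambda)$ are pairwise distinct (equivalently $b_1\notin\{4,5,\dots,2N+2\}$ for W, $b_4\notin\{q^4,q^5,\dots,q^{2N+2}\}$ for AW), both polynomials are non-zero and $\Xi_{\mathcal{D}}=c\,\bar\Xi_{\bar{\mathcal{D}}}$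 with a constant $c\ne0$, that is, $$\varphi_M(x)^{-1}\,\mathrm{W}_\gamma[\check\xi_{d_1},\dots,\check\xi_{d_M}](x;\lambda)=c\;\varphi_{N+1-M}(x)^{-1}\,\mathrm{W}_\gamma[\check P_{e_1},\dots,\check P_{e_{N+1-M}}](x;\bar\lambda)$$ at every $x\in\mathbb{C}$ where $\varphi_M(x)\varphi_{N+1-M}(x)\ne0$. -/

import Mathlib

noncomputable section

namespace CasoratianIdentities

open Complex

/-! ### Shifted factorials -/

/-- The shifted factorial `(a)_n = a (a+1) ⋯ (a+n-1)`. -/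
def poch (a : ℂ) (n : ℕ) : ℂ := (ascPochhammer ℂ n).eval a

/-- The `q`-shifted factorial `(a;q)_n = (1-a)(1-aq)⋯(1-aq^{n-1})`. -/
def qPoch (a q : ℂ) (n : ℕ) : ℂ := ∏ i ∈ Finset.range n, (1 - a * q ^ i)

theorem poch_eq_prod (a : ℂ) (n : ℕ) : poch a n = ∏ i ∈ Finset.range n, (a + i) := by
  induction n with
  | zero => simp [poch]
  | succ n ih =>
    rw [Finset.prod_range_succ, ← ih, poch, poch, ascPochhammer_succ_eval]

theorem poch_split (a : ℂ) {k n : ℕ} (h : k ≤ n) :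
    poch a n = poch a k * poch (a + k) (n - k) := by
  obtain ⟨m, rfl⟩ := Nat.exists_eq_add_of_le h
  simp only [poch_eq_prod, Nat.add_sub_cancel_left, Finset.prod_range_add]
  congr 1
  refine Finset.prod_congr rfl fun i _ => ?_
  push_cast
  ring

theorem qPoch_split (a q : ℂ) {k n : ℕ} (h : k ≤ n) :
    qPoch a q n = qPoch a q k * qPoch (a * q ^ k) q (n - k) := by
  obtain ⟨m, rfl⟩ := Nat.exists_eq_add_of_le h
  simp only [qPoch, Nat.add_sub_cancel_left, Finset.prod_range_add]
  congr 1
  refine Finset.prod_congr rfl fun i _ => ?_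
  ring

/-! ### The Wilson and the Askey-Wilson polynomials -/

/-- The Wilson polynomial `W_n(η; a₁,a₂,a₃,a₄)` as a polynomial in `η`.
The prefactor `(a₁+a₂,a₁+a₃,a₁+a₄)_n` is multiplied into the terminating `₄F₃` series, by means of
`(c)_n / (c)_k = (c+k)_{n-k}`, and `(a₁+ix)_k (a₁-ix)_k = ∏_{i<k} ((a₁+i)² + x²)`;
so this is a polynomial in the parameters as well, without any exceptional values. -/
def wilson (n : ℕ) (a : Fin 4 → ℂ) : Polynomial ℂ :=
  ∑ k ∈ Finset.range (n + 1),
    Polynomial.C (poch (-n) k * poch (n + (a 0 + a 1 + a 2 + a 3) - 1) k / (k.factorial : ℂ)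
        * (poch (a 0 + a 1 + k) (n - k) * poch (a 0 + a 2 + k) (n - k)
          * poch (a 0 + a 3 + k) (n - k)))
      * ∏ i ∈ Finset.range k, (Polynomial.C ((a 0 + i) ^ 2) + Polynomial.X)

/-- The Askey-Wilson polynomial `p_n(η; a₁,a₂,a₃,a₄ | q)` as a polynomial in `η` (for `a₁ ≠ 0`),
the prefactor `(a₁a₂,a₁a₃,a₁a₄;q)_n` being multiplied into the terminating `₄φ₃` series and
`(a₁e^{ix}, a₁e^{-ix}; q)_k = ∏_{i<k} (1 - 2a₁q^i cos x + a₁²q^{2i})`. -/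
def askeyWilson (q : ℂ) (n : ℕ) (a : Fin 4 → ℂ) : Polynomial ℂ :=
  ∑ k ∈ Finset.range (n + 1),
    Polynomial.C ((a 0 ^ n)⁻¹
        * (qPoch ((q ^ n)⁻¹) q k * qPoch (a 0 * a 1 * a 2 * a 3 * q ^ ((n : ℤ) - 1)) q k * q ^ k
          / qPoch q q k)
        * (qPoch (a 0 * a 1 * q ^ k) q (n - k) * qPoch (a 0 * a 2 * q ^ k) q (n - k)
          * qPoch (a 0 * a 3 * q ^ k) q (n - k)))
      * ∏ i ∈ Finset.range k,
          (1 - Polynomial.C (2 * a 0 * q ^ i) * Polynomial.X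
            + Polynomial.C (a 0 ^ 2 * q ^ (2 * i)))

/-- Where the hypergeometric series makes sense, `wilson` is given by its usual expression
`(a₁+a₂,a₁+a₃,a₁+a₄)_n ₄F₃(-n, n+b₁-1, a₁+ix, a₁-ix; a₁+a₂, a₁+a₃, a₁+a₄; 1)`. -/
theorem wilson_eval (n : ℕ) (a : Fin 4 → ℂ) (x : ℂ)
    (h1 : poch (a 0 + a 1) n ≠ 0) (h2 : poch (a 0 + a 2) n ≠ 0) (h3 : poch (a 0 + a 3) n ≠ 0) :
    (wilson n a).eval (x ^ 2) =
      poch (a 0 + a 1) n * poch (a 0 + a 2) n * poch (a 0 + a 3) n *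
        ∑ k ∈ Finset.range (n + 1),
          poch (-n) k * poch (n + (a 0 + a 1 + a 2 + a 3) - 1) k
              * poch (a 0 + I * x) k * poch (a 0 - I * x) k
            / (poch (a 0 + a 1) k * poch (a 0 + a 2) k * poch (a 0 + a 3) k
              * (k.factorial : ℂ)) := by
  rw [wilson, Polynomial.eval_finsetSum, Finset.mul_sum]
  refine Finset.sum_congr rfl fun k hk => ?_
  have hkn : k ≤ n := Nat.lt_succ_iff.mp (Finset.mem_range.mp hk)
  have hp : (∏ i ∈ Finset.range k, ((a 0 + i) ^ 2 + x ^ 2))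
      = poch (a 0 + I * x) k * poch (a 0 - I * x) k := by
    rw [poch_eq_prod, poch_eq_prod, ← Finset.prod_mul_distrib]
    refine Finset.prod_congr rfl fun i _ => ?_
    linear_combination (x ^ 2) * I_sq
  rw [poch_split _ hkn] at h1 h2 h3
  rw [poch_split (a 0 + a 1) hkn, poch_split (a 0 + a 2) hkn, poch_split (a 0 + a 3) hkn]
  have hf : (k.factorial : ℂ) ≠ 0 := by exact_mod_cast k.factorial_ne_zero
  have g1 := left_ne_zero_of_mul h1
  have g2 := left_ne_zero_of_mul h2
  have g3 := left_ne_zero_of_mul h3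
  simp only [Polynomial.eval_mul, Polynomial.eval_C, Polynomial.eval_prod, Polynomial.eval_add,
    Polynomial.eval_X, hp]
  field_simp

/-- Where the basic hypergeometric series makes sense, `askeyWilson` is given by its usual
expression `a₁^{-n} (a₁a₂,a₁a₃,a₁a₄;q)_n
₄φ₃(q^{-n}, b₄q^{n-1}, a₁e^{ix}, a₁e^{-ix}; a₁a₂, a₁a₃, a₁a₄ | q; q)`. -/
theorem askeyWilson_eval (q : ℂ) (n : ℕ) (a : Fin 4 → ℂ) (x : ℂ)
    (h1 : qPoch (a 0 * a 1) q n ≠ 0) (h2 : qPoch (a 0 * a 2) q n ≠ 0)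
    (h3 : qPoch (a 0 * a 3) q n ≠ 0) :
    (askeyWilson q n a).eval (cos x) =
      (a 0 ^ n)⁻¹ * (qPoch (a 0 * a 1) q n * qPoch (a 0 * a 2) q n * qPoch (a 0 * a 3) q n) *
        ∑ k ∈ Finset.range (n + 1),
          qPoch ((q ^ n)⁻¹) q k * qPoch (a 0 * a 1 * a 2 * a 3 * q ^ ((n : ℤ) - 1)) q k
              * qPoch (a 0 * exp (I * x)) q k * qPoch (a 0 * exp (-(I * x))) q k
            / (qPoch (a 0 * a 1) q k * qPoch (a 0 * a 2) q k * qPoch (a 0 * a 3) q k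
              * qPoch q q k) * q ^ k := by
  rw [askeyWilson, Polynomial.eval_finsetSum, Finset.mul_sum]
  refine Finset.sum_congr rfl fun k hk => ?_
  have hkn : k ≤ n := Nat.lt_succ_iff.mp (Finset.mem_range.mp hk)
  have hp : (∏ i ∈ Finset.range k, (1 - 2 * a 0 * q ^ i * cos x + a 0 ^ 2 * q ^ (2 * i)))
      = qPoch (a 0 * exp (I * x)) q k * qPoch (a 0 * exp (-(I * x))) q k := by
    rw [qPoch, qPoch, ← Finset.prod_mul_distrib]
    refine Finset.prod_congr rfl fun i _ => ?_
    have he : exp (I * x) * exp (-(I * x)) = 1 := by rw [← exp_add]; simp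
    have hc : 2 * cos x = exp (I * x) + exp (-(I * x)) := by
      rw [two_cos, mul_comm x I]
      congr 2
      ring
    linear_combination (-(a 0 * q ^ i)) * hc - (a 0 ^ 2 * q ^ (2 * i)) * he
  rw [qPoch_split _ _ hkn] at h1 h2 h3
  rw [qPoch_split (a 0 * a 1) _ hkn, qPoch_split (a 0 * a 2) _ hkn, qPoch_split (a 0 * a 3) _ hkn]
  have g1 := left_ne_zero_of_mul h1
  have g2 := left_ne_zero_of_mul h2
  have g3 := left_ne_zero_of_mul h3
  simp only [Polynomial.eval_mul, Polynomial.eval_C, Polynomial.eval_prod, Polynomial.eval_add,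
    Polynomial.eval_sub, Polynomial.eval_one, Polynomial.eval_X, hp]
  have key : ∀ A B B' K K' D Q u1 u2 u3 v1 v2 v3 : ℂ, u1 ≠ 0 → u2 ≠ 0 → u3 ≠ 0 →
      A * (B * B' * D / Q) * (v1 * v2 * v3) * (K * K') =
        A * (u1 * v1 * (u2 * v2) * (u3 * v3)) * (B * B' * K * K' / (u1 * u2 * u3 * Q) * D) := by
    intro A B B' K K' D Q u1 u2 u3 v1 v2 v3 hu1 hu2 hu3
    rw [← div_div (B * B' * K * K'), div_eq_mul_inv _ Q, div_eq_mul_inv _ Q]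
    generalize Q⁻¹ = R
    field_simp
  exact key _ _ _ _ _ _ _ _ _ _ _ _ _ g1 g2 g3

/-! ### The Casorati determinant -/

/-- The Casoratian
`W_γ[f_1,…,f_n](x) = i^{n(n-1)/2} det (f_k(x_j))_{1≤j,k≤n}`, `x_j = x + i((n+1)/2 - j)γ`.
The row index `j : Fin n` stands for the number `j + 1`. -/
def casoratian (γ : ℂ) {n : ℕ} (f : Fin n → ℂ → ℂ) (x : ℂ) : ℂ :=
  I ^ (n * (n - 1) / 2) *
    (Matrix.of fun j k : Fin n =>
      f k (x + I * (((n : ℂ) + 1) / 2 - (((j : ℕ) : ℂ) + 1)) * γ)).det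

/-! ### The two families and their data -/

/-- The two families: Wilson, and Askey-Wilson with `0 < q < 1`. -/
inductive Family
  | W : Family
  | AW (q : ℝ) (hq0 : 0 < q) (hq1 : q < 1) : Family

namespace Family

/-- The shift: `γ = 1` for Wilson, `γ = log q` for Askey-Wilson. -/
def γ : Family → ℂ
  | W => 1
  | AW q _ _ => (Real.log q : ℝ)

/-- The sinusoidal coordinate `η(x)`: `x²`, respectively `cos x`. -/
def η : Family → ℂ → ℂ
  | W, x => x ^ 2
  | AW _ _ _, x => cos x

/-- The auxiliary function `φ(x)`: `2x`, respectively `2 sin x`. -/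
def φ : Family → ℂ → ℂ
  | W, x => 2 * x
  | AW _ _ _, x => 2 * sin x

/-- The parameters `(a₁,a₂,a₃,a₄)` as functions of `λ`: `a = λ`, respectively `a = q^λ`. -/
def a : Family → (Fin 4 → ℂ) → Fin 4 → ℂ
  | W, l => l
  | AW q _ _, l => fun j => (q : ℂ) ^ (l j)

/-- The polynomial `P_n(η; λ)`. -/
def P (F : Family) (n : ℕ) (l : Fin 4 → ℂ) : Polynomial ℂ :=
  match F with
  | W => wilson n (W.a l)
  | AW q h0 h1 => askeyWilson (q : ℂ) n ((AW q h0 h1).a l)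

/-- The eigenvalue `E_n(λ)`: `n(n+b₁-1)` with `b₁ = a₁+a₂+a₃+a₄`, respectively
`(q^{-n}-1)(1-b₄q^{n-1})` with `b₄ = a₁a₂a₃a₄`. -/
def E (F : Family) (n : ℕ) (l : Fin 4 → ℂ) : ℂ :=
  match F with
  | W => n * (n + ∑ j, W.a l j - 1)
  | AW q h0 h1 =>
      (((q : ℂ) ^ n)⁻¹ - 1) * (1 - (∏ j, (AW q h0 h1).a l j) * (q : ℂ) ^ ((n : ℤ) - 1))

/-- `φ_M(x) = φ(x)^{[M/2]} ∏_{k=1}^{M-2} (φ(x - i(k/2)γ) φ(x + i(k/2)γ))^{[(M-k)/2]}`;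
the product is empty for `M ≤ 2`. -/
def phiM (F : Family) (M : ℕ) (x : ℂ) : ℂ :=
  F.φ x ^ (M / 2) *
    ∏ k ∈ Finset.Icc 1 (M - 2),
      (F.φ (x - I * ((k : ℂ) / 2) * F.γ) * F.φ (x + I * ((k : ℂ) / 2) * F.γ)) ^ ((M - k) / 2)

end Family

/-- The shift `δ = (1/2,1/2,1/2,1/2)` of the parameters. -/
def δ : Fin 4 → ℂ := fun _ => 1 / 2

/-- The twist `𝔱(λ) = (1-λ₁,1-λ₂,1-λ₃,1-λ₄)`. -/
def twist (l : Fin 4 → ℂ) : Fin 4 → ℂ := fun j => 1 - l j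

/-- The shifted parameters `λ̄ = λ - (N+1)δ`. -/
def barParam (N : ℕ) (l : Fin 4 → ℂ) : Fin 4 → ℂ := l - ((N : ℂ) + 1) • δ

/-- The set `D̄ = {0,1,…,N} \ {N-d_1,…,N-d_M}` (used for `d_j ≤ N` only). -/
def barD (N : ℕ) {M : ℕ} (d : Fin M → ℕ) : Finset ℕ :=
  Finset.range (N + 1) \ Finset.univ.image fun j => N - d j

namespace Family

/-- `ξ_v(η; λ) = P_v(η; 𝔱(λ))`. -/
def ξ (F : Family) (v : ℕ) (l : Fin 4 → ℂ) : Polynomial ℂ := F.P v (twist l)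

/-- The Casoratian `W_γ[ξ̌_{d_1},…,ξ̌_{d_M}](x; λ)`, where `ξ̌_v(x) = ξ_v(η(x))`. -/
def twistedCasoratian (F : Family) {M : ℕ} (d : Fin M → ℕ) (l : Fin 4 → ℂ) (x : ℂ) : ℂ :=
  casoratian F.γ (fun (j : Fin M) (y : ℂ) => (F.ξ (d j) l).eval (F.η y)) x

/-- The Casoratian `W_γ[P̌_{e_1},…,P̌_{e_m}](x; λ)` for a finite set
`{e_1 < … < e_m}` of degrees, where `P̌_n(x) = P_n(η(x))`. -/
def eigenCasoratian (F : Family) (S : Finset ℕ) (l : Fin 4 → ℂ) (x : ℂ) : ℂ :=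
  casoratian F.γ
    (fun (j : Fin S.card) (y : ℂ) => (F.P (S.orderEmbOfFin rfl j) l).eval (F.η y)) x

end Family

end CasoratianIdentities

end

/-! The source of the duality is the kernel `K(x,y) = ∏_{p<N} (η(y) - η(x + i((N+1)/2 - p - 1)γ))`.
The differences of `η` factor through an odd function `s` satisfying a three-term relation. This
relation yields a Pascal rule for the symmetric binomials, and hence an expansion of `K` in products
of Newton polynomials in `η(y)` and `η(x)` that is diagonal, pairing degree `k` with degree `N - k`
(`kernel_expansion`).

In a Newton basis both families are eigenvectors of bidiagonal matrices. The matrix for `λ̄` and the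
reversed matrix for `𝔱(λ)` have the same eigenvalues up to a constant shift (`e_twist_sub`), and the
diagonal matrix of `K` intertwines them. If the eigenvalues are distinct, `K` stays diagonal in the
eigenbases: `K(x,y) = ∑ g_k P_k(η(y); λ̄) ξ_{N-k}(η(x); λ)` with all `g_k ≠ 0`
(`exists_kernel_eq_sum`).

Now let `x` run through `M` and `y` through `m = N + 1 - M` consecutive shifts of one point. Each
such `y` is one of the `N` shifts occurring in `K(x,·)`, so `K` vanishes on this grid, and the two
matrices of values have product zero. Complementary minors of such matrices are proportional
(`det_submatrix_mul_det_submatrix_eq_sign_mul`). The constant is read off from the lowest degrees,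
where both minors are Vandermonde determinants, i.e. constant multiples of `φ_M` and `φ_m`
(`exists_vand_eq`).

Three things remain. The quotients by `φ_n` are polynomials in `η` for any parameters, because
Vandermonde determinants divide and reflection symmetry makes the quotient even
(`exists_evalDet_eq_phiM_mul`). They are non-zero for generic parameters by Casorati's criterion
(`exists_det_eval_ne_zero`). Exceptional parameters are reached by continuity, after eliminating the
constant by cross-multiplication (`evalDet_mul_evalDet_symm`). -/

noncomputable section

namespace CasoratianIdentities

open Complex

/-! ### Arithmetic of the sinusoidal coordinate -/

namespace Family

/-- The odd function `S` with `η y - η x = κ S (y + x) S (y - x)`, read off on the line `I γ c`: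
`S(u) = u`, respectively `S(u) = 2 sin (u / 2)`. -/
def s : Family → ℂ → ℂ
  | W, c => I * c
  | AW q _ _, c => 2 * sin (I * (Real.log q : ℝ) * c / 2)

/-- The constant `κ` in `η y - η x = κ S (y + x) S (y - x)`. -/
def κ : Family → ℂ
  | W => 1
  | AW _ _ _ => -1 / 2

/-- The sinusoidal coordinate at the point `I γ c`. -/
def ηs (F : Family) (c : ℂ) : ℂ := F.η (I * F.γ * c)

theorem κ_ne_zero (F : Family) : F.κ ≠ 0 := by
  cases F <;> simp [κ]

theorem γ_eq_ofReal (F : Family) : ∃ r : ℝ, r ≠ 0 ∧ F.γ = r := by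
  cases F with
  | W => exact ⟨1, one_ne_zero, by simp [γ]⟩
  | AW q h0 h1 => exact ⟨Real.log q, (Real.log_neg h0 h1).ne, rfl⟩

theorem γ_ne_zero (F : Family) : F.γ ≠ 0 := by
  obtain ⟨r, hr, h⟩ := F.γ_eq_ofReal
  rw [h]
  exact_mod_cast hr

theorem s_neg (F : Family) (c : ℂ) : F.s (-c) = -F.s c := by
  cases F with
  | W => simp [s]
  | AW q h0 h1 =>
    simp only [s]
    rw [show I * (Real.log q : ℝ) * -c / 2 = -(I * (Real.log q : ℝ) * c / 2) by ring, sin_neg]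
    ring

theorem s_zero (F : Family) : F.s 0 = 0 := by
  cases F <;> simp [s]

/-- The one identity of `s` behind both the Pascal rule and the factorization of eigenvalue
differences; it holds for a linear function and for a sine alike, so that both families can be
treated together. -/
theorem s_three_term (F : Family) (a b z : ℂ) :
    F.s a * F.s (z + b) + F.s b * F.s (z - a) = F.s (a + b) * F.s z := by
  cases F with
  | W => simp only [s]; ring
  | AW q h0 h1 =>
    simp only [s]
    generalize hL : I * (Real.log q : ℝ) = L
    rw [show L * (z + b) / 2 = L * z / 2 + L * b / 2 by ring,
      show L * (z - a) / 2 = L * z / 2 - L * a / 2 by ring,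
      show L * (a + b) / 2 = L * a / 2 + L * b / 2 by ring, sin_add, sin_add, sin_sub]
    ring

theorem ηs_sub (F : Family) (y x : ℂ) :
    F.ηs y - F.ηs x = F.κ * F.s (y + x) * F.s (y - x) := by
  cases F with
  | W =>
    simp only [s, ηs, η, γ, κ]
    ring
  | AW q h0 h1 =>
    simp only [s, ηs, η, γ, κ]
    rw [cos_sub_cos]
    rw [show (I * (Real.log q : ℝ) * y + I * (Real.log q : ℝ) * x) / 2
      = I * (Real.log q : ℝ) * (y + x) / 2 by ring,
      show (I * (Real.log q : ℝ) * y - I * (Real.log q : ℝ) * x) / 2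
      = I * (Real.log q : ℝ) * (y - x) / 2 by ring]
    ring

theorem φ_I_γ_mul (F : Family) (c : ℂ) : F.φ (I * F.γ * c) = F.s (2 * c) := by
  cases F with
  | W => simp only [φ, s, γ]; ring
  | AW q h0 h1 =>
    simp only [φ, s, γ]
    rw [show I * (Real.log q : ℝ) * (2 * c) / 2 = I * (Real.log q : ℝ) * c by ring]

/-- Since `γ` is real and non-zero, the zeros of `s` lie on the imaginary axis. This makes `s`
non-zero at non-zero integers, and lets a real shift of the parameters avoid all coincidences of
eigenvalues. -/
theorem re_eq_zero_of_s_eq_zero (F : Family) {c : ℂ} (h : F.s c = 0) : c.re = 0 := by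
  cases F with
  | W =>
    simp only [s, mul_eq_zero, I_ne_zero, false_or] at h
    simp [h]
  | AW q h0 h1 =>
    simp only [s, mul_eq_zero, OfNat.ofNat_ne_zero, false_or] at h
    rw [sin_eq_zero_iff] at h
    obtain ⟨k, hk⟩ := h
    have := congrArg im hk
    simp only [div_ofNat_im, mul_im, mul_re, I_re, I_im, ofReal_re, ofReal_im, intCast_re,
      intCast_im] at this
    have hl : Real.log q ≠ 0 := (Real.log_neg h0 h1).ne
    have h2 : Real.log q * c.re = 0 := by linarith
    exact (mul_eq_zero.mp h2).resolve_left hl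

theorem s_natCast_ne_zero (F : Family) {n : ℕ} (hn : n ≠ 0) : F.s n ≠ 0 := fun h => by
  have := F.re_eq_zero_of_s_eq_zero h
  simp [hn] at this

/-- The zeros of `φ` have real part `0` or an integer multiple of `π`. The strip is stable under the
imaginary shifts by multiples of `iγ`, so every factor of `φ_M` is non-zero there. -/
theorem φ_ne_zero_of_re_mem (F : Family) {x : ℂ} (hx : x.re ∈ Set.Ioo (0 : ℝ) 1) :
    F.φ x ≠ 0 := by
  cases F with
  | W =>
    simp only [φ, ne_eq, mul_eq_zero, OfNat.ofNat_ne_zero, false_or]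
    rintro rfl
    simp at hx
  | AW q h0 h1 =>
    simp only [φ, ne_eq, mul_eq_zero, OfNat.ofNat_ne_zero, false_or, sin_eq_zero_iff]
    rintro ⟨k, rfl⟩
    simp only [mul_re, intCast_re, ofReal_re, intCast_im, ofReal_im, mul_zero, sub_zero,
      Set.mem_Ioo] at hx
    have hk : (0 : ℝ) < k := by
      by_contra h
      nlinarith [Real.pi_pos, hx.1]
    have hk1 : (1 : ℝ) ≤ k := by
      have : (0 : ℤ) < k := by exact_mod_cast hk
      exact_mod_cast this
    nlinarith [Real.pi_gt_three, hx.2]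

theorem injOn_η_ofReal (F : Family) : Set.InjOn (fun x : ℝ => F.η x) (Set.Ioo 0 1) := by
  intro x hx y hy h
  cases F with
  | W =>
    simp only [η] at h
    have h' : x ^ 2 = y ^ 2 := by exact_mod_cast h
    exact (pow_left_inj₀ hx.1.le hy.1.le two_ne_zero).mp h'
  | AW q h0 h1 =>
    simp only [η] at h
    have h' : Real.cos x = Real.cos y := by exact_mod_cast h
    have hpi := Real.pi_gt_three
    exact Real.injOn_cos ⟨hx.1.le, by linarith [hx.2]⟩ ⟨hy.1.le, by linarith [hy.2]⟩ h'

theorem η_neg (F : Family) (x : ℂ) : F.η (-x) = F.η x := by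
  cases F <;> simp [η]

/-! ### Symmetric binomial coefficients and the kernel expansion -/

/-- The symmetric binomial coefficient attached to `s`. -/
def sBinom (F : Family) (N k : ℕ) : ℂ := ∏ i ∈ Finset.range k, F.s ((N : ℂ) - i) / F.s (i + 1)

theorem s_succ_ne_zero (F : Family) (k : ℕ) : F.s ((k : ℂ) + 1) ≠ 0 := by
  exact_mod_cast F.s_natCast_ne_zero k.succ_ne_zero

theorem sBinom_zero (F : Family) (N : ℕ) : F.sBinom N 0 = 1 := by simp [sBinom]

theorem sBinom_succ_mul (F : Family) (N k : ℕ) :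
    F.sBinom N (k + 1) * F.s (k + 1) = F.sBinom N k * F.s ((N : ℂ) - k) := by
  rw [sBinom, Finset.prod_range_succ, ← sBinom, mul_assoc,
    div_mul_cancel₀ _ (F.s_succ_ne_zero k)]

theorem sBinom_self_succ (F : Family) (N : ℕ) : F.sBinom N (N + 1) = 0 := by
  have := F.sBinom_succ_mul N N
  rw [sub_self, s_zero, mul_zero] at this
  exact (mul_eq_zero.mp this).resolve_right (F.s_succ_ne_zero N)

theorem sBinom_ne_zero (F : Family) {N k : ℕ} (h : k ≤ N) : F.sBinom N k ≠ 0 := by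
  refine Finset.prod_ne_zero_iff.mpr fun i hi => div_ne_zero ?_ (F.s_succ_ne_zero i)
  have hi' : i < N := (Finset.mem_range.mp hi).trans_le h
  rw [← Nat.cast_sub hi'.le]
  exact F.s_natCast_ne_zero (by omega)

theorem sBinom_succ_succ_mul (F : Family) (N k : ℕ) :
    F.sBinom (N + 1) (k + 1) * F.s (k + 1) = F.s (N + 1) * F.sBinom N k := by
  induction k with
  | zero =>
    rw [sBinom_succ_mul, sBinom_zero, sBinom_zero]
    simp
  | succ k ih =>
    have h1 := F.s_succ_ne_zero k
    apply mul_right_cancel₀ h1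
    rw [sBinom_succ_mul, mul_assoc (F.s _), sBinom_succ_mul, ← mul_assoc, ← ih]
    push_cast
    rw [show (N : ℂ) + 1 - (k + 1) = N - k by ring]
    ring

/-- The Pascal rule for the symmetric binomial coefficients. -/
theorem sBinom_pascal (F : Family) (N k : ℕ) (z : ℂ) :
    F.sBinom N k * F.s (z + (N - k)) + F.sBinom N (k + 1) * F.s (z - (k + 1))
      = F.sBinom (N + 1) (k + 1) * F.s z := by
  have h1 := F.s_succ_ne_zero k
  apply mul_right_cancel₀ h1
  have h2 := F.s_three_term (k + 1) (N - k) z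
  rw [show (k : ℂ) + 1 + (N - k) = N + 1 by ring] at h2
  linear_combination F.s (z - (k + 1)) * F.sBinom_succ_mul N k
    - F.s z * F.sBinom_succ_succ_mul N k + F.sBinom N k * h2

/-- The expansion of the kernel `∏ (η(y) - η(x_j))` over a window of `N` consecutive shifts of `x`
in products of Newton bases, with nodes in arithmetic progression. -/
theorem kernel_expansion (F : Family) (N : ℕ) (u X Y : ℂ) :
    ∏ p ∈ Finset.range N, (F.ηs Y - F.ηs (X + (((N : ℂ) + 1) / 2 - (p + 1))))
      = ∑ k ∈ Finset.range (N + 1), (-1) ^ (N + k) * F.sBinom N k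
        * (∏ i ∈ Finset.range k, (F.ηs Y - F.ηs (u - ((N : ℂ) + 1) / 2 + i)))
        * ∏ i ∈ Finset.range (N - k), (F.ηs X - F.ηs (1 - u + i)) := by
  induction N generalizing u X with
  | zero => simp [sBinom_zero]
  | succ N ih =>
    -- Splitting off the last factor leaves the kernel of size `N` at `X + 1/2`. Using the induction
    -- hypothesis at `u - 1/2` keeps the Newton nodes in `Y` unchanged. The factors `p`, `r`
    -- separate the two `s`-factors of each difference in `X`, since only the second kind changes
    -- when `X + 1/2`, `u - 1/2` return to `X`, `u`.
    set bY : ℕ → ℂ := fun k =>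
      ∏ i ∈ Finset.range k, (F.ηs Y - F.ηs (u - ((N : ℂ) + 2) / 2 + i)) with hbY
    set p : ℕ → ℂ := fun n => ∏ i ∈ Finset.range n, (F.κ * F.s (X - 1 + u - i)) with hp
    set r : ℕ → ℂ := fun n => ∏ i ∈ Finset.range n, F.s (X + 2 - u + i) with hr
    have hpr : ∀ n, ∏ i ∈ Finset.range n, (F.ηs (X + 1 / 2) - F.ηs (1 - (u - 1 / 2) + i))
        = p n * r n := fun n => by
      rw [hp, hr, ← Finset.prod_mul_distrib]
      refine Finset.prod_congr rfl fun i _ => ?_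
      rw [ηs_sub, show X + 1 / 2 + (1 - (u - 1 / 2) + i) = X + 2 - u + i by ring,
        show X + 1 / 2 - (1 - (u - 1 / 2) + i) = X - 1 + u - i by ring]
      ring
    have hpr' : ∀ n, ∏ i ∈ Finset.range (n + 1), (F.ηs X - F.ηs (1 - u + i))
        = p (n + 1) * r n * F.s (X + 1 - u) := fun n => by
      have h3 : r n * F.s (X + 1 - u) = ∏ i ∈ Finset.range (n + 1), F.s (X + 1 - u + i) := by
        rw [Finset.prod_range_succ', hr]
        congr 1
        · refine Finset.prod_congr rfl fun i _ => ?_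
          congr 1
          push_cast
          ring
        · simp
      rw [mul_assoc, h3, hp, ← Finset.prod_mul_distrib]
      refine Finset.prod_congr rfl fun i _ => ?_
      rw [ηs_sub, show X + (1 - u + i) = X + 1 - u + i by ring,
        show X - (1 - u + i) = X - 1 + u - i by ring]
      ring
    -- The removed factor is compared with the `k`-th Newton node: one part raises the degree in
    -- `Y`, the other supplies factors in `X`. The two contributions to each degree then combine by
    -- the Pascal rule.
    have hlast : ∀ k ≤ N, F.ηs Y - F.ηs (X - N / 2)
        = (F.ηs Y - F.ηs (u - ((N : ℂ) + 2) / 2 + k))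
          - (F.κ * F.s (X - 1 + u - ((N - k : ℕ) : ℂ))) * F.s (X + 1 - u - k) := fun k hk => by
      rw [Nat.cast_sub hk]
      have := F.ηs_sub (X - N / 2) (u - ((N : ℂ) + 2) / 2 + k)
      rw [show X - N / 2 + (u - ((N : ℂ) + 2) / 2 + k) = X - 1 + u - (N - k) by ring,
        show X - N / 2 - (u - ((N : ℂ) + 2) / 2 + k) = X + 1 - u - k by ring] at this
      rw [← this]
      ring
    have hK : ∏ p ∈ Finset.range (N + 1),
          (F.ηs Y - F.ηs (X + (((N + 1 : ℕ) : ℂ) + 1) / 2 - (p + 1)))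
        = (∏ p ∈ Finset.range N, (F.ηs Y - F.ηs (X + 1 / 2 + (((N : ℂ) + 1) / 2 - (p + 1)))))
          * (F.ηs Y - F.ηs (X - N / 2)) := by
      rw [Finset.prod_range_succ]
      congr 1
      · refine Finset.prod_congr rfl fun i _ => ?_
        congr 2
        push_cast
        ring
      · congr 2
        push_cast
        ring
    have hstep : ∀ k ∈ Finset.range (N + 1),
        ((-1) ^ (N + k) * F.sBinom N k
          * (∏ i ∈ Finset.range k, (F.ηs Y - F.ηs (u - 1 / 2 - ((N : ℂ) + 1) / 2 + i)))
          * ∏ i ∈ Finset.range (N - k), (F.ηs (X + 1 / 2) - F.ηs (1 - (u - 1 / 2) + i)))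
          * (F.ηs Y - F.ηs (X - N / 2))
        = (-1) ^ (N + k) * F.sBinom N k * bY (k + 1) * (p (N - k) * r (N - k))
          - (-1) ^ (N + k) * F.sBinom N k * bY k * (p (N + 1 - k) * r (N - k))
            * F.s (X + 1 - u - k) := fun k hk => by
      have hk : k ≤ N := Nat.lt_succ_iff.mp (Finset.mem_range.mp hk)
      have e1 : (∏ i ∈ Finset.range k, (F.ηs Y - F.ηs (u - 1 / 2 - ((N : ℂ) + 1) / 2 + i)))
          = bY k := Finset.prod_congr rfl fun i _ => by
        congr 2
        ring
      have e2 : bY (k + 1) = bY k * (F.ηs Y - F.ηs (u - ((N : ℂ) + 2) / 2 + k)) :=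
        Finset.prod_range_succ _ _
      have e3 : p (N + 1 - k) = p (N - k) * (F.κ * F.s (X - 1 + u - ((N - k : ℕ) : ℂ))) := by
        rw [show N + 1 - k = N - k + 1 by omega]
        exact Finset.prod_range_succ _ _
      rw [hpr, e1, hlast k hk, e2, e3]
      ring
    have hfin : ∀ k ∈ Finset.range (N + 1),
        (-1) ^ (N + 1 + (k + 1)) * F.sBinom (N + 1) (k + 1) * bY (k + 1)
          * ∏ i ∈ Finset.range (N + 1 - (k + 1)), (F.ηs X - F.ηs (1 - u + i))
        = (-1) ^ (N + k) * F.sBinom N k * bY (k + 1) * (p (N - k) * r (N - k))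
          - (-1) ^ (N + (k + 1)) * F.sBinom N (k + 1) * bY (k + 1)
            * (p (N + 1 - (k + 1)) * r (N - (k + 1))) * F.s (X + 1 - u - (k + 1 : ℕ)) :=
        fun k hk => by
      have hk : k ≤ N := Nat.lt_succ_iff.mp (Finset.mem_range.mp hk)
      rw [show N + 1 - (k + 1) = N - k by omega]
      -- At `k = N` the second Pascal term is absent because `sBinom N (N + 1) = 0`; there the rule
      -- only says that the two top coefficients agree.
      rcases hk.eq_or_lt with rfl | hk
      · have h1 := F.sBinom_pascal k k 1
        have h2 := F.sBinom_pascal k k (k + 1)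
        have h3 := F.s_succ_ne_zero k
        rw [sBinom_self_succ] at h2 ⊢
        simp only [sub_self, add_zero, s_zero, mul_zero] at h2
        have h4 := mul_right_cancel₀ h3 (by simpa using h2)
        rw [← h4]
        simp only [Nat.sub_self, Finset.range_zero, Finset.prod_empty, hp, hr]
        ring
      · obtain ⟨m, hm⟩ : ∃ m, N = k + 1 + m := Nat.exists_eq_add_of_le hk
        have h1 : N - k = m + 1 := by omega
        have h2 : N - (k + 1) = m := by omega
        have h3 : r (m + 1) = r m * F.s (X + 1 - u + (N - k)) := by
          rw [hr]
          simp only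
          rw [Finset.prod_range_succ, hm]
          congr 2
          push_cast
          ring
        have h4 := F.sBinom_pascal N k (X + 1 - u)
        rw [h1, h2, hpr', h3]
        push_cast
        linear_combination (-(-1) ^ (N + k) * bY (k + 1) * p (m + 1) * r m) * h4
    have hzero : (-1) ^ (N + 1 + 0) * F.sBinom (N + 1) 0 * bY 0
          * ∏ i ∈ Finset.range (N + 1 - 0), (F.ηs X - F.ηs (1 - u + i))
        = - ((-1) ^ (N + 0) * F.sBinom N 0 * bY 0 * (p (N + 1 - 0) * r (N - 0))
          * F.s (X + 1 - u - (0 : ℕ))) := by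
      rw [sBinom_zero, sBinom_zero, Nat.sub_zero, Nat.sub_zero, hpr']
      push_cast
      rw [sub_zero]
      ring
    have hK' : ∏ p ∈ Finset.range (N + 1),
          (F.ηs Y - F.ηs (X + ((((N + 1 : ℕ) : ℂ) + 1) / 2 - (p + 1))))
        = ∏ p ∈ Finset.range (N + 1),
          (F.ηs Y - F.ηs (X + (((N + 1 : ℕ) : ℂ) + 1) / 2 - (p + 1))) :=
      Finset.prod_congr rfl fun i _ => by
        congr 2
        ring
    have hbY' : ∀ k, ∏ i ∈ Finset.range k, (F.ηs Y - F.ηs (u - (((N + 1 : ℕ) : ℂ) + 1) / 2 + i))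
        = bY k := fun k => Finset.prod_congr rfl fun i _ => by
      congr 2
      push_cast
      ring
    rw [hK', hK, ih (u - 1 / 2) (X + 1 / 2), Finset.sum_mul, Finset.sum_congr rfl hstep]
    simp_rw [hbY']
    rw [Finset.sum_range_succ' _ (N + 1), Finset.sum_congr rfl hfin, hzero,
      Finset.sum_sub_distrib, Finset.sum_sub_distrib]
    have hshift : ∑ k ∈ Finset.range (N + 1), (-1) ^ (N + k) * F.sBinom N k * bY k
          * (p (N + 1 - k) * r (N - k)) * F.s (X + 1 - u - k)
        = ∑ k ∈ Finset.range (N + 1), (-1) ^ (N + (k + 1)) * F.sBinom N (k + 1) * bY (k + 1)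
            * (p (N + 1 - (k + 1)) * r (N - (k + 1))) * F.s (X + 1 - u - (k + 1 : ℕ))
          + (-1) ^ (N + 0) * F.sBinom N 0 * bY 0 * (p (N + 1 - 0) * r (N - 0))
          * F.s (X + 1 - u - (0 : ℕ)) := by
      rw [← Finset.sum_range_succ' (fun k => (-1) ^ (N + k) * F.sBinom N k * bY k
          * (p (N + 1 - k) * r (N - k)) * F.s (X + 1 - u - k)) (N + 1),
        Finset.sum_range_succ _ (N + 1), sBinom_self_succ]
      ring
    rw [hshift]
    ring

end Family

/-! ### Newton coefficients of the Wilson and Askey-Wilson polynomials -/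

theorem poch_succ (a : ℂ) (k : ℕ) : poch a (k + 1) = poch a k * (a + k) := by
  simp only [poch_eq_prod, Finset.prod_range_succ]

theorem poch_add_natCast_eq (a : ℂ) {k n : ℕ} (h : k < n) :
    poch (a + k) (n - k) = (a + k) * poch (a + (k + 1 : ℕ)) (n - (k + 1)) := by
  rw [poch_split (a + k) (k := 1) (n := n - k) (by omega), show n - k - 1 = n - (k + 1) by omega]
  simp [poch_eq_prod, add_assoc]

theorem qPoch_succ (a q : ℂ) (k : ℕ) : qPoch a q (k + 1) = qPoch a q k * (1 - a * q ^ k) := by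
  simp only [qPoch, Finset.prod_range_succ]

theorem qPoch_mul_pow_eq (a q : ℂ) {k n : ℕ} (h : k < n) :
    qPoch (a * q ^ k) q (n - k) = (1 - a * q ^ k) * qPoch (a * q ^ (k + 1)) q (n - (k + 1)) := by
  rw [qPoch_split (a * q ^ k) q (k := 1) (n := n - k) (by omega),
    show n - k - 1 = n - (k + 1) by omega]
  simp [qPoch, pow_succ, mul_assoc]

namespace Family

/-- The Newton basis polynomial `∏_{i<k} (X - η(I γ (c + i)))`. -/
def newton (F : Family) (c : ℂ) (k : ℕ) : Polynomial ℂ :=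
  ∏ i ∈ Finset.range k, (Polynomial.X - Polynomial.C (F.ηs (c + i)))

/-- The coefficients of a polynomial family in a Newton basis satisfy the two-term recursion
of the operator with the eigenvalues `s(n) s(n + b₁ - 1)`. -/
structure IsEigenCoeff (F : Family) (n : ℕ) (l : Fin 4 → ℂ) (c : ℕ → ℂ) : Prop where
  zero_of_lt : ∀ k : ℕ, n < k → c k = 0
  recursion : ∀ k : ℕ, F.κ * (F.s (k + 1) * F.s (l 0 + l 1 + k) * F.s (l 0 + l 2 + k)
    * F.s (l 0 + l 3 + k)) * c (k + 1)
      = F.s ((n : ℂ) - k) * F.s (n + k + (l 0 + l 1 + l 2 + l 3) - 1) * c k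
  diag_ne_zero : (∀ k : ℕ, k < n → F.s (n + k + (l 0 + l 1 + l 2 + l 3) - 1) ≠ 0) → c n ≠ 0

/-- Truncating after degree `n` respects the recursion: at `k = n` its right-hand side contains
`s(0) = 0`. -/
theorem isEigenCoeff_ite (F : Family) (n : ℕ) (l : Fin 4 → ℂ) (c : ℕ → ℂ)
    (hrec : ∀ k : ℕ, k < n → F.κ * (F.s (k + 1) * F.s (l 0 + l 1 + k) * F.s (l 0 + l 2 + k)
    * F.s (l 0 + l 3 + k)) * c (k + 1)
      = F.s ((n : ℂ) - k) * F.s (n + k + (l 0 + l 1 + l 2 + l 3) - 1) * c k)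
    (hdiag : (∀ k : ℕ, k < n → F.s (n + k + (l 0 + l 1 + l 2 + l 3) - 1) ≠ 0) → c n ≠ 0) :
    F.IsEigenCoeff n l (fun k => if k ≤ n then c k else 0) where
  zero_of_lt k hk := if_neg hk.not_ge
  recursion k := by
    rcases lt_trichotomy k n with h | rfl | h
    · simp only [h.le, Nat.succ_le_of_lt h, if_true, hrec k h]
    · simp [s_zero]
    · simp [h.not_ge, (show ¬ k + 1 ≤ n by omega)]
  diag_ne_zero h := by simpa using hdiag h

/-- The recursion is the ratio of consecutive terms of the `₄F₃` series, cleared of denominators;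
the Newton nodes `-(a₁+i)²` are the roots of the factors in the series. -/
theorem exists_isEigenCoeff_wilson (n : ℕ) (l : Fin 4 → ℂ) :
    ∃ c, W.IsEigenCoeff n l c ∧
      W.P n l = ∑ k ∈ Finset.range (n + 1), Polynomial.C (c k) * W.newton (l 0) k := by
  refine ⟨_, W.isEigenCoeff_ite n l (fun k =>
    poch (-n) k * poch (n + (l 0 + l 1 + l 2 + l 3) - 1) k / (k.factorial : ℂ)
        * (poch (l 0 + l 1 + k) (n - k) * poch (l 0 + l 2 + k) (n - k)
          * poch (l 0 + l 3 + k) (n - k))) ?_ ?_, ?_⟩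
  · intro k hk
    have hf : (k.factorial : ℂ) ≠ 0 := by exact_mod_cast k.factorial_ne_zero
    have hk1 : (k : ℂ) + 1 ≠ 0 := by exact_mod_cast k.succ_ne_zero
    rw [poch_succ, poch_succ, poch_add_natCast_eq (l 0 + l 1) hk,
      poch_add_natCast_eq (l 0 + l 2) hk, poch_add_natCast_eq (l 0 + l 3) hk, Nat.factorial_succ]
    simp only [s, κ]
    push_cast
    generalize poch (l 0 + l 1 + (k + 1)) (n - (k + 1)) = t1
    generalize poch (l 0 + l 2 + (k + 1)) (n - (k + 1)) = t2
    generalize poch (l 0 + l 3 + (k + 1)) (n - (k + 1)) = t3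
    generalize poch (-n) k = t4
    generalize poch (n + (l 0 + l 1 + l 2 + l 3) - 1) k = t5
    generalize (k.factorial : ℂ) = t6 at *
    generalize (k : ℂ) = x at *
    rw [div_eq_mul_inv, div_eq_mul_inv, mul_inv]
    have hw : (x + 1) * (x + 1)⁻¹ = 1 := mul_inv_cancel₀ hk1
    generalize (x + 1)⁻¹ = w at *
    linear_combination (t6⁻¹ * (l 0 + l 1 + x) * (l 0 + l 2 + x) * (l 0 + l 3 + x) * t1 * t2 * t3
      * t4 * t5 * (x - n) * (n + (l 0 + l 1 + l 2 + l 3) - 1 + x)) * (I ^ 4 * hw + (I ^ 2) * I_sq)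
  · intro h
    simp only [Nat.sub_self]
    have h0 : ∀ a, poch a 0 = 1 := fun a => by simp [poch_eq_prod]
    simp only [h0, mul_one]
    refine div_ne_zero (mul_ne_zero ?_ ?_) (by exact_mod_cast n.factorial_ne_zero)
    · rw [poch_eq_prod, Finset.prod_ne_zero_iff]
      intro i hi he
      have : (i : ℂ) = n := by linear_combination he
      exact (Finset.mem_range.mp hi).ne (by exact_mod_cast this)
    · rw [poch_eq_prod, Finset.prod_ne_zero_iff]
      intro i hi he
      refine h i (Finset.mem_range.mp hi) ?_
      simp only [s]
      linear_combination I * he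
  · simp only [P, wilson, newton, a]
    refine Finset.sum_congr rfl fun k hk => ?_
    rw [if_pos (Nat.lt_succ_iff.mp (Finset.mem_range.mp hk))]
    congr 1
    refine Finset.prod_congr rfl fun i _ => ?_
    simp only [ηs, η, γ]
    rw [mul_one, mul_pow, I_sq, neg_one_mul, map_neg, sub_neg_eq_add, add_comm]

theorem ofReal_cpow_eq_exp {q : ℝ} (h0 : 0 < q) (c : ℂ) :
    (q : ℂ) ^ c = exp ((Real.log q : ℝ) * c) := by
  rw [cpow_def_of_ne_zero (by exact_mod_cast h0.ne'), ofReal_log h0.le]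

theorem exp_log_mul_natCast {q : ℝ} (h0 : 0 < q) (k : ℕ) :
    exp ((Real.log q : ℝ) * k) = (q : ℂ) ^ k := by
  rw [← ofReal_cpow_eq_exp h0, cpow_natCast]

/-- Translates `q`-shifted factorials into `s`: `1 - q^c` is `s(c)` up to the unit `i q^{c/2}`. -/
theorem one_sub_exp_eq (q : ℝ) (h0 : 0 < q) (h1 : q < 1) (c : ℂ) :
    1 - exp ((Real.log q : ℝ) * c)
      = I * exp ((Real.log q : ℝ) * c / 2) * (AW q h0 h1).s c := by
  simp only [s, sin]
  rw [show -(I * (Real.log q : ℝ) * c / 2) * I = (Real.log q : ℝ) * c / 2 by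
      linear_combination (-((Real.log q : ℝ) * c / 2)) * I_sq,
    show (I * (Real.log q : ℝ) * c / 2) * I = -((Real.log q : ℝ) * c / 2) by
      linear_combination (((Real.log q : ℝ) * c / 2)) * I_sq,
    show exp ((Real.log q : ℝ) * c) = exp ((Real.log q : ℝ) * c / 2) ^ 2 by
      rw [sq, ← exp_add]; congr 1; ring, exp_neg]
  have := exp_ne_zero ((Real.log q : ℝ) * c / 2)
  field_simp
  linear_combination (1 - exp ((Real.log q : ℝ) * c / 2) ^ 2) * I_sq

theorem exists_isEigenCoeff_askeyWilson (q : ℝ) (h0 : 0 < q) (h1 : q < 1) (n : ℕ)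
    (l : Fin 4 → ℂ) :
    ∃ c, (AW q h0 h1).IsEigenCoeff n l c ∧ (AW q h0 h1).P n l
      = ∑ k ∈ Finset.range (n + 1), Polynomial.C (c k) * (AW q h0 h1).newton (l 0) k := by
  have hq : (q : ℂ) ≠ 0 := by exact_mod_cast h0.ne'
  have ha : ∀ j, (AW q h0 h1).a l j = exp ((Real.log q : ℝ) * l j) := fun j =>
    ofReal_cpow_eq_exp h0 _
  set a := (AW q h0 h1).a l with hadef
  have hb : ∀ i : ℕ, a 0 * a 1 * a 2 * a 3 * (q : ℂ) ^ ((n : ℤ) - 1) * (q : ℂ) ^ i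
      = exp ((Real.log q : ℝ) * (n + i + (l 0 + l 1 + l 2 + l 3) - 1)) := fun i => by
    have e : (q : ℂ) ^ ((n : ℤ) - 1) = exp ((Real.log q : ℝ) * ((n : ℂ) - 1)) := by
      rw [← ofReal_cpow_eq_exp h0, ← cpow_intCast]
      push_cast
      rfl
    rw [ha, ha, ha, ha, e, ← exp_log_mul_natCast h0 i]
    simp only [← exp_add]
    congr 1
    ring
  have hn : ∀ i : ℕ, ((q : ℂ) ^ n)⁻¹ * (q : ℂ) ^ i = exp ((Real.log q : ℝ) * ((i : ℂ) - n)) :=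
      fun i => by
    rw [← exp_log_mul_natCast h0 n, ← exp_log_mul_natCast h0 i, ← exp_neg, ← exp_add]
    congr 1
    ring
  have haa : ∀ i j : Fin 4, ∀ k : ℕ, a i * a j * (q : ℂ) ^ k
      = exp ((Real.log q : ℝ) * (l i + l j + k)) := fun i j k => by
    rw [ha, ha, ← exp_log_mul_natCast h0 k, ← exp_add, ← exp_add]
    congr 1
    ring
  have hqk : ∀ k : ℕ, (q : ℂ) * (q : ℂ) ^ k = exp ((Real.log q : ℝ) * ((k : ℂ) + 1)) :=
      fun k => by
    rw [← pow_succ', ← exp_log_mul_natCast h0]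
    push_cast
    rfl
  have hs := one_sub_exp_eq q h0 h1
  have hqq : ∀ k : ℕ, 1 - (q : ℂ) * (q : ℂ) ^ k ≠ 0 := fun k => by
    rw [hqk, hs]
    exact mul_ne_zero (mul_ne_zero I_ne_zero (exp_ne_zero _)) (s_succ_ne_zero _ k)
  have hqPoch : ∀ k, qPoch q q k ≠ 0 := fun k =>
    Finset.prod_ne_zero_iff.mpr fun i _ => hqq i
  refine ⟨_, (AW q h0 h1).isEigenCoeff_ite n l (fun k => (a 0 ^ n)⁻¹
        * (qPoch (((q : ℂ) ^ n)⁻¹) q k * qPoch (a 0 * a 1 * a 2 * a 3 * (q : ℂ) ^ ((n : ℤ) - 1)) q k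
            * (q : ℂ) ^ k / qPoch q q k)
        * (qPoch (a 0 * a 1 * (q : ℂ) ^ k) q (n - k) * qPoch (a 0 * a 2 * (q : ℂ) ^ k) q (n - k)
          * qPoch (a 0 * a 3 * (q : ℂ) ^ k) q (n - k))
        -- The factors of the `₄φ₃` series are not monic in `η`; this product collects their leading
        -- coefficients.
        * ∏ i ∈ Finset.range k, (-2 * a 0 * (q : ℂ) ^ i)) ?_ ?_, ?_⟩
  · intro k hk
    simp only [qPoch_succ, qPoch_mul_pow_eq _ _ hk, Finset.prod_range_succ]
    have hk1 := hqq k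
    have hk2 := hqPoch k
    -- The term ratio of the series: after each `1 - q^c` is replaced by `s(c)`, the half-integral
    -- powers of `q` on the two sides balance, as `hexp` records.
    have key : (1 - (q : ℂ) * (q : ℂ) ^ k) * (1 - a 0 * a 1 * (q : ℂ) ^ k)
        * (1 - a 0 * a 2 * (q : ℂ) ^ k) * (1 - a 0 * a 3 * (q : ℂ) ^ k)
        * ((AW q h0 h1).s ((n : ℂ) - k)
          * (AW q h0 h1).s (n + k + (l 0 + l 1 + l 2 + l 3) - 1))
        = (-1 / 2) * ((AW q h0 h1).s (k + 1) * (AW q h0 h1).s (l 0 + l 1 + k)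
          * (AW q h0 h1).s (l 0 + l 2 + k) * (AW q h0 h1).s (l 0 + l 3 + k))
        * ((1 - ((q : ℂ) ^ n)⁻¹ * (q : ℂ) ^ k)
          * (1 - a 0 * a 1 * a 2 * a 3 * (q : ℂ) ^ ((n : ℤ) - 1) * (q : ℂ) ^ k)
          * (-2 * a 0 * (q : ℂ) ^ k) * q) := by
      rw [hb, hn, haa, haa, haa, hqk, hs, hs, hs, hs, hs, hs, ha,
        ← neg_sub (n : ℂ) (k : ℂ), s_neg]
      have hexp : exp ((Real.log q : ℝ) * ((k : ℂ) + 1) / 2)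
          * exp ((Real.log q : ℝ) * (l 0 + l 1 + k) / 2)
          * exp ((Real.log q : ℝ) * (l 0 + l 2 + k) / 2)
          * exp ((Real.log q : ℝ) * (l 0 + l 3 + k) / 2)
          = exp ((Real.log q : ℝ) * -((n : ℂ) - k) / 2)
          * exp ((Real.log q : ℝ) * (n + k + (l 0 + l 1 + l 2 + l 3) - 1) / 2)
          * exp ((Real.log q : ℝ) * l 0) * ((q : ℂ) * (q : ℂ) ^ k) := by
        rw [hqk]
        simp only [← exp_add]
        congr 1
        ring
      generalize exp ((Real.log q : ℝ) * ((k : ℂ) + 1) / 2) = x1 at *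
      generalize exp ((Real.log q : ℝ) * (l 0 + l 1 + k) / 2) = x2 at *
      generalize exp ((Real.log q : ℝ) * (l 0 + l 2 + k) / 2) = x3 at *
      generalize exp ((Real.log q : ℝ) * (l 0 + l 3 + k) / 2) = x4 at *
      generalize exp ((Real.log q : ℝ) * -((n : ℂ) - k) / 2) = y1 at *
      generalize exp ((Real.log q : ℝ) * (n + k + (l 0 + l 1 + l 2 + l 3) - 1) / 2) = y2 at *
      generalize exp ((Real.log q : ℝ) * l 0) = y3 at *
      generalize (AW q h0 h1).s ((n : ℂ) - k) = s1
      generalize (AW q h0 h1).s (n + k + (l 0 + l 1 + l 2 + l 3) - 1) = s2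
      generalize (AW q h0 h1).s (k + 1) = s3
      generalize (AW q h0 h1).s (l 0 + l 1 + k) = s4
      generalize (AW q h0 h1).s (l 0 + l 2 + k) = s5
      generalize (AW q h0 h1).s (l 0 + l 3 + k) = s6
      linear_combination (I ^ 4 * s1 * s2 * s3 * s4 * s5 * s6) * hexp
        + I ^ 2 * s1 * s2 * s3 * s4 * s5 * s6 * y1 * y2 * y3 * q * q ^ k * I_sq
    simp only [κ]
    rw [pow_succ (q : ℂ) k]
    generalize qPoch (((q : ℂ) ^ n)⁻¹) q k = t1
    generalize qPoch (a 0 * a 1 * a 2 * a 3 * (q : ℂ) ^ ((n : ℤ) - 1)) q k = t2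
    generalize qPoch (a 0 * a 1 * ((q : ℂ) ^ k * q)) q (n - (k + 1)) = t3
    generalize qPoch (a 0 * a 2 * ((q : ℂ) ^ k * q)) q (n - (k + 1)) = t4
    generalize qPoch (a 0 * a 3 * ((q : ℂ) ^ k * q)) q (n - (k + 1)) = t5
    generalize (a 0 ^ n)⁻¹ = t6
    generalize (∏ i ∈ Finset.range k, (-2 * a 0 * (q : ℂ) ^ i)) = t7
    generalize qPoch (q : ℂ) q k = t8 at *
    generalize 1 - (q : ℂ) * (q : ℂ) ^ k = w at *
    generalize 1 - a 0 * a 1 * (q : ℂ) ^ k = w1 at *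
    generalize 1 - a 0 * a 2 * (q : ℂ) ^ k = w2 at *
    generalize 1 - a 0 * a 3 * (q : ℂ) ^ k = w3 at *
    generalize 1 - ((q : ℂ) ^ n)⁻¹ * (q : ℂ) ^ k = w4 at *
    generalize 1 - a 0 * a 1 * a 2 * a 3 * (q : ℂ) ^ ((n : ℤ) - 1) * (q : ℂ) ^ k = w5 at *
    generalize (AW q h0 h1).s ((n : ℂ) - k) = s1 at *
    generalize (AW q h0 h1).s (n + k + (l 0 + l 1 + l 2 + l 3) - 1) = s2 at *
    generalize (AW q h0 h1).s (k + 1) = s3 at *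
    generalize (AW q h0 h1).s (l 0 + l 1 + k) = s4 at *
    generalize (AW q h0 h1).s (l 0 + l 2 + k) = s5 at *
    generalize (AW q h0 h1).s (l 0 + l 3 + k) = s6 at *
    rw [div_eq_mul_inv _ (t8 * w), div_eq_mul_inv _ t8, mul_inv t8 w]
    have hw : w * w⁻¹ = 1 := mul_inv_cancel₀ hk1
    linear_combination (-(w⁻¹ * t1 * t2 * t3 * t4 * t5 * t6 * t7 * t8⁻¹ * q ^ k)) * key
      + (t1 * t2 * t3 * t4 * t5 * t6 * t7 * t8⁻¹ * q ^ k * w1 * w2 * w3 * s1 * s2) * hw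
  · intro h
    have h00 : ∀ a, qPoch a q 0 = 1 := fun a => by simp [qPoch]
    have ha0 : a 0 ≠ 0 := by rw [ha]; exact exp_ne_zero _
    simp only [Nat.sub_self, h00, mul_one]
    refine mul_ne_zero (mul_ne_zero (inv_ne_zero (pow_ne_zero _ ha0)) (div_ne_zero
      (mul_ne_zero (mul_ne_zero ?_ ?_) (pow_ne_zero _ hq)) (hqPoch n))) ?_
    · refine Finset.prod_ne_zero_iff.mpr fun i hi => ?_
      have hi : i < n := Finset.mem_range.mp hi
      rw [hn, hs, ← neg_sub (n : ℂ) (i : ℂ), s_neg, ← Nat.cast_sub hi.le]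
      exact mul_ne_zero (mul_ne_zero I_ne_zero (exp_ne_zero _))
        (neg_ne_zero.mpr (s_natCast_ne_zero _ (by omega)))
    · refine Finset.prod_ne_zero_iff.mpr fun i hi => ?_
      rw [hb, hs]
      exact mul_ne_zero (mul_ne_zero I_ne_zero (exp_ne_zero _)) (h i (Finset.mem_range.mp hi))
    · refine Finset.prod_ne_zero_iff.mpr fun i _ => ?_
      exact mul_ne_zero (mul_ne_zero (by norm_num) ha0) (pow_ne_zero _ hq)
  · simp only [P, askeyWilson, newton]
    refine Finset.sum_congr rfl fun k hk => ?_
    rw [if_pos (Nat.lt_succ_iff.mp (Finset.mem_range.mp hk)), map_mul _ _ (∏ i ∈ _, _),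
      mul_assoc (Polynomial.C _), map_prod, ← Finset.prod_mul_distrib]
    congr 1
    refine Finset.prod_congr rfl fun i _ => ?_
    have e1 : a 0 * (q : ℂ) ^ i = exp ((Real.log q : ℝ) * (l 0 + i)) := by
      rw [ha, ← exp_log_mul_natCast h0 i, ← exp_add]
      congr 1
      ring
    have e2 : 2 * (a 0 * (q : ℂ) ^ i) * (AW q h0 h1).ηs (l 0 + i)
        = 1 + a 0 ^ 2 * (q : ℂ) ^ (2 * i) := by
      rw [mul_comm 2 i, pow_mul, ← mul_pow, e1]
      simp only [ηs, η, γ, cos]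
      rw [show -(I * (Real.log q : ℝ) * (l 0 + i)) * I = (Real.log q : ℝ) * (l 0 + i) by
          linear_combination (-((Real.log q : ℝ) * (l 0 + i))) * I_sq,
        show (I * (Real.log q : ℝ) * (l 0 + i)) * I = -((Real.log q : ℝ) * (l 0 + i)) by
          linear_combination (((Real.log q : ℝ) * (l 0 + i))) * I_sq, exp_neg]
      have := exp_ne_zero ((Real.log q : ℝ) * (l 0 + i))
      field_simp
    have e3 := congrArg Polynomial.C e2
    simp only [map_mul, map_add, map_one, map_pow, map_neg] at e3 ⊢
    linear_combination -e3

theorem exists_isEigenCoeff (F : Family) (n : ℕ) (l : Fin 4 → ℂ) :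
    ∃ c, F.IsEigenCoeff n l c ∧
      F.P n l = ∑ k ∈ Finset.range (n + 1), Polynomial.C (c k) * F.newton (l 0) k := by
  cases F with
  | W => exact exists_isEigenCoeff_wilson n l
  | AW q h0 h1 => exact exists_isEigenCoeff_askeyWilson q h0 h1 n l

/-- The eigenvalues in the normalization `s(n) s(n + b₁ - 1)` agree with `E` up to a non-zero
constant. -/
theorem exists_E_eq (F : Family) (l : Fin 4 → ℂ) : ∃ t : ℂ, t ≠ 0 ∧
    ∀ n : ℕ, F.E n l = t * (F.s n * F.s (n + (l 0 + l 1 + l 2 + l 3) - 1)) := by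
  cases F with
  | W =>
    refine ⟨-1, by norm_num, fun n => ?_⟩
    simp only [E, s, a, Fin.sum_univ_four]
    linear_combination (n * (n + (l 0 + l 1 + l 2 + l 3) - 1)) * I_sq
  | AW q h0 h1 =>
    refine ⟨-exp ((Real.log q : ℝ) * (l 0 + l 1 + l 2 + l 3 - 1) / 2),
      neg_ne_zero.mpr (exp_ne_zero _), fun n => ?_⟩
    have hs := one_sub_exp_eq q h0 h1
    have e1 : (∏ j, (AW q h0 h1).a l j) * (q : ℂ) ^ ((n : ℤ) - 1)
        = exp ((Real.log q : ℝ) * (n + (l 0 + l 1 + l 2 + l 3) - 1)) := by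
      simp only [Fin.prod_univ_four, a]
      rw [← cpow_intCast]
      push_cast
      simp only [ofReal_cpow_eq_exp h0, ← exp_add]
      congr 1
      ring
    have e2 : ((q : ℂ) ^ n)⁻¹ - 1 = exp (-((Real.log q : ℝ) * n)) * (1 - exp ((Real.log q : ℝ) * n))
        := by
      rw [mul_sub, ← exp_add, ← exp_log_mul_natCast h0, exp_neg]
      simp
    have e3 : exp (-((Real.log q : ℝ) * (n : ℂ))) * exp ((Real.log q : ℝ) * (n : ℂ) / 2)
        * exp ((Real.log q : ℝ) * (n + (l 0 + l 1 + l 2 + l 3) - 1) / 2)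
        = exp ((Real.log q : ℝ) * (l 0 + l 1 + l 2 + l 3 - 1) / 2) := by
      simp only [← exp_add]
      congr 1
      ring
    simp only [E]
    rw [e1, e2, hs, hs, ← e3]
    linear_combination (exp (-((Real.log q : ℝ) * (n : ℂ))) * exp ((Real.log q : ℝ) * (n : ℂ) / 2)
        * exp ((Real.log q : ℝ) * (n + (l 0 + l 1 + l 2 + l 3) - 1) / 2)
        * (AW q h0 h1).s n * (AW q h0 h1).s (n + (l 0 + l 1 + l 2 + l 3) - 1)) * I_sq

end Family

/-! ### Two facts of linear algebra -/

/-- If two triangularizable operators are intertwined by a diagonal matrix, this diagonal matrix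
stays diagonal in the two bases of eigenvectors. -/
theorem exists_diagonal_eq_transpose_mul {n K : Type*} [Fintype n] [DecidableEq n] [Field K]
    {L L' T T' : Matrix n n K} {C e : n → K} (hL : IsUnit L.det) (hL' : IsUnit L'.det)
    (hC : ∀ k, C k ≠ 0) (he : Function.Injective e)
    (hT : L * T = Matrix.diagonal e * L) (hT' : L' * T' = Matrix.diagonal e * L')
    (hTT' : T.transpose * Matrix.diagonal C = Matrix.diagonal C * T') :
    ∃ g : n → K, (∀ k, g k ≠ 0) ∧
      Matrix.diagonal C = L.transpose * Matrix.diagonal g * L' := by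
  have hLt : IsUnit L.transpose.det := by rwa [Matrix.det_transpose]
  set G := L.transpose⁻¹ * Matrix.diagonal C * L'⁻¹ with hG
  have hCG : Matrix.diagonal C = L.transpose * G * L' := by
    rw [hG, mul_assoc, Matrix.nonsing_inv_mul_cancel_right _ _ hL',
      Matrix.mul_nonsing_inv_cancel_left _ _ hLt]
  -- In the eigenbases the intertwining relation says that `G` commutes with a diagonal matrix with
  -- distinct entries, which forces `G` to be diagonal.
  have hcomm : Matrix.diagonal e * G = G * Matrix.diagonal e := by
    have h1 : L.transpose * (Matrix.diagonal e * G) * L'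
        = L.transpose * (G * Matrix.diagonal e) * L' := by
      calc L.transpose * (Matrix.diagonal e * G) * L'
          = (L.transpose * Matrix.diagonal e) * G * L' := by simp only [mul_assoc]
        _ = (T.transpose * L.transpose) * G * L' := by
          rw [← Matrix.transpose_mul, hT, Matrix.transpose_mul, Matrix.diagonal_transpose]
        _ = T.transpose * (L.transpose * G * L') := by simp only [mul_assoc]
        _ = (L.transpose * G * L') * T' := by rw [← hCG, hTT']
        _ = L.transpose * G * (L' * T') := by simp only [mul_assoc]
        _ = L.transpose * (G * Matrix.diagonal e) * L' := by rw [hT']; simp only [mul_assoc]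
    have h2 := congrArg (fun A => L.transpose⁻¹ * (A * L'⁻¹)) h1
    simpa only [mul_assoc, Matrix.mul_nonsing_inv _ hL', mul_one,
      Matrix.nonsing_inv_mul_cancel_left _ _ hLt] using h2
  have hdiag : G = Matrix.diagonal fun k => G k k := by
    ext i j
    rcases eq_or_ne i j with rfl | hij
    · simp
    · rw [Matrix.diagonal_apply_ne _ hij]
      have h := congrFun (congrFun hcomm i) j
      rw [Matrix.diagonal_mul, Matrix.mul_diagonal] at h
      have h' : (e i - e j) * G i j = 0 := by linear_combination h
      exact (mul_eq_zero.mp h').resolve_left (sub_ne_zero.mpr (he.ne hij))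
  refine ⟨fun k => G k k, fun k hk => ?_, by rw [← hdiag, ← hCG]⟩
  have hdet := congrArg Matrix.det hCG
  rw [hdiag, Matrix.det_mul, Matrix.det_mul, Matrix.det_diagonal, Matrix.det_diagonal,
    Finset.prod_eq_zero (f := fun k => G k k) (Finset.mem_univ k) hk, mul_zero, zero_mul] at hdet
  exact Finset.prod_ne_zero_iff.mpr (fun k _ => hC k) hdet

/-- Complementary minors of two matrices with product zero are proportional. -/
theorem det_submatrix_mul_det_submatrix_eq_sign_mul {m₁ m₂ n R : Type*} [Fintype m₁]
    [DecidableEq m₁] [Fintype m₂] [DecidableEq m₂] [Fintype n] [DecidableEq n] [CommRing R]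
    (A : Matrix m₁ n R) (B : Matrix n m₂ R) (hAB : A * B = 0) (σ τ : m₁ ⊕ m₂ ≃ n) :
    (A.submatrix id (τ ∘ Sum.inl)).det * (B.submatrix (σ ∘ Sum.inr) id).det
      = (Equiv.Perm.sign (σ.trans τ.symm) : R)
        * ((A.submatrix id (σ ∘ Sum.inl)).det * (B.submatrix (τ ∘ Sum.inr) id).det) := by
  -- Both matrices are completed to square ones by rows or columns of the identity. Since `A * B =
  -- 0`, `X * Y` is block triangular and its determinant is one product of minors, while `det X` and
  -- `det Y` give the other after a permutation.
  set X : Matrix (m₁ ⊕ m₂) n R :=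
    Matrix.fromRows A ((1 : Matrix n n R).submatrix (σ ∘ Sum.inr) id) with hX
  set Y : Matrix n (m₁ ⊕ m₂) R :=
    Matrix.fromCols ((1 : Matrix n n R).submatrix id (τ ∘ Sum.inl)) B with hY
  have hXY : X * Y = Matrix.fromBlocks (A.submatrix id (τ ∘ Sum.inl)) 0
      ((1 : Matrix n n R).submatrix (σ ∘ Sum.inr) (τ ∘ Sum.inl))
      (B.submatrix (σ ∘ Sum.inr) id) := by
    rw [hX, hY, Matrix.fromRows_mul_fromCols, hAB]
    congr 1
    · ext i j
      simp [Matrix.mul_apply, Matrix.one_apply]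
    · ext i j
      simp [Matrix.mul_apply, Matrix.one_apply]
    · ext i j
      simp [Matrix.mul_apply, Matrix.one_apply]
  have hXσ : (X.submatrix id σ).det = (A.submatrix id (σ ∘ Sum.inl)).det := by
    have : X.submatrix id σ = Matrix.fromBlocks (A.submatrix id (σ ∘ Sum.inl))
        (A.submatrix id (σ ∘ Sum.inr)) 0 1 := by
      ext (i | i) (j | j) <;> simp [hX, Matrix.one_apply]
    rw [this, Matrix.det_fromBlocks_zero₂₁, Matrix.det_one, mul_one]
  have hYτ : (Y.submatrix τ id).det = (B.submatrix (τ ∘ Sum.inr) id).det := by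
    have : Y.submatrix τ id = Matrix.fromBlocks 1 (B.submatrix (τ ∘ Sum.inl) id) 0
        (B.submatrix (τ ∘ Sum.inr) id) := by
      ext (i | i) (j | j) <;> simp [hY, Matrix.one_apply]
    rw [this, Matrix.det_fromBlocks_zero₂₁, Matrix.det_one, one_mul]
  have hYσ : (Y.submatrix σ id).det
      = (Equiv.Perm.sign (σ.trans τ.symm) : R) * (Y.submatrix τ id).det := by
    rw [← Matrix.det_permute]
    congr 1
    ext i j
    simp
  have h := congrArg Matrix.det hXY
  rw [Matrix.det_fromBlocks_zero₁₂] at h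
  rw [← h, ← hXσ, ← hYτ]
  have h2 : X * Y = (X.submatrix id σ) * (Y.submatrix σ id) := by
    rw [Matrix.submatrix_mul_equiv, Matrix.submatrix_id_id]
  rw [h2, Matrix.det_mul, hYσ]
  ring

/-! ### Duality of the eigenvalues and the kernel in the eigenbases -/

namespace Family

/-- The sum of the four parameters. -/
def parSum (l : Fin 4 → ℂ) : ℂ := l 0 + l 1 + l 2 + l 3

/-- The eigenvalues in the normalization `s(n) s(n + b₁ - 1)`. -/
def e (F : Family) (l : Fin 4 → ℂ) (n : ℕ) : ℂ := F.s n * F.s (n + parSum l - 1)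

theorem e_sub (F : Family) (l : Fin 4 → ℂ) (n k : ℕ) :
    F.e l n - F.e l k = F.s ((n : ℂ) - k) * F.s (n + k + parSum l - 1) := by
  have h' := F.s_three_term (n - k) k (n + parSum l - 1)
  rw [show (n : ℂ) + parSum l - 1 + k = n + k + parSum l - 1 by ring,
    show (n : ℂ) + parSum l - 1 - (n - k) = k + parSum l - 1 by ring,
    show (n : ℂ) - k + k = n by ring] at h'
  simp only [e]
  linear_combination -h'

theorem parSum_barParam (N : ℕ) (l : Fin 4 → ℂ) :
    parSum (barParam N l) = parSum l - 2 * ((N : ℂ) + 1) := by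
  simp only [parSum, barParam, δ, Pi.sub_apply, Pi.smul_apply, smul_eq_mul]
  ring

theorem parSum_twist (l : Fin 4 → ℂ) : parSum (twist l) = 4 - parSum l := by
  simp only [parSum, twist]
  ring

/-- The duality of the eigenvalues. -/
theorem e_twist_sub (F : Family) (N : ℕ) (l : Fin 4 → ℂ) {k : ℕ} (hk : k ≤ N) :
    F.e (twist l) (N - k) - F.e (twist l) N = F.e (barParam N l) k := by
  rw [e_sub, e, parSum_twist, parSum_barParam, Nat.cast_sub hk,
    show (N : ℂ) - k - N = -k by ring, s_neg,
    show (N : ℂ) - k + N + (4 - parSum l) - 1 = -(k + (parSum l - 2 * ((N : ℂ) + 1)) - 1) by ring,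
    s_neg]
  ring

theorem injOn_e_iff (F : Family) (l : Fin 4 → ℂ) (N : ℕ) :
    Set.InjOn (F.e l) (Set.Iic N) ↔ Set.InjOn (fun n => F.E n l) (Set.Iic N) := by
  obtain ⟨t, ht, h⟩ := F.exists_E_eq l
  have h' : ∀ n, F.E n l = t * F.e l n := h
  simp only [Set.InjOn, h', mul_right_inj' ht]

theorem IsEigenCoeff.sum_eq {F : Family} {n : ℕ} {l : Fin 4 → ℂ} {c : ℕ → ℂ}
    (h : F.IsEigenCoeff n l c) {N : ℕ} (hn : n ≤ N) (f : ℕ → ℂ) :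
    ∑ k ∈ Finset.range (n + 1), c k * f k = ∑ k : Fin (N + 1), c k * f k := by
  rw [Fin.sum_univ_eq_sum_range (fun k => c k * f k) (N + 1)]
  refine Finset.sum_subset (Finset.range_mono (by omega)) fun k _ hk => ?_
  rw [h.zero_of_lt k (by simpa using hk), zero_mul]

/-- By `e_sub` the recursion is an eigenvector equation: the coefficient row is a left eigenvector
of a bidiagonal matrix independent of `n`. -/
theorem IsEigenCoeff.recursion' {F : Family} {n : ℕ} {l : Fin 4 → ℂ} {c : ℕ → ℂ}
    (h : F.IsEigenCoeff n l c) (k : ℕ) : F.e l k * c k + F.κ * (F.s (k + 1)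
      * F.s (l 0 + l 1 + k) * F.s (l 0 + l 2 + k) * F.s (l 0 + l 3 + k)) * c (k + 1)
      = F.e l n * c k := by
  have h1 := F.e_sub l n k
  have h2 := h.recursion k
  rw [parSum] at h1
  linear_combination h2 - c k * h1

theorem IsEigenCoeff.diag_ne_zero_of_injOn {F : Family} {n N : ℕ} {l : Fin 4 → ℂ} {c : ℕ → ℂ}
    (h : F.IsEigenCoeff n l c) (he : Set.InjOn (F.e l) (Set.Iic N)) (hn : n ≤ N) : c n ≠ 0 := by
  refine h.diag_ne_zero fun k hk h0 => hk.ne' (he (Set.mem_Iic.mpr hn)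
    (Set.mem_Iic.mpr (hk.le.trans hn)) (sub_eq_zero.mp ?_))
  rw [e_sub, parSum, h0, mul_zero]

/-- By `e_twist_sub` the twisted eigenvalues are the others in reversed order, up to an additive
constant. -/
theorem injOn_e_twist (F : Family) {N : ℕ} {l : Fin 4 → ℂ}
    (he : Set.InjOn (F.e (barParam N l)) (Set.Iic N)) :
    Set.InjOn (F.e (twist l)) (Set.Iic N) := by
  intro i hi j hj hij
  rw [Set.mem_Iic] at hi hj
  have h1 := F.e_twist_sub N l (Nat.sub_le N i)
  have h2 := F.e_twist_sub N l (Nat.sub_le N j)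
  rw [Nat.sub_sub_self hi] at h1
  rw [Nat.sub_sub_self hj, ← hij, h1] at h2
  have := he (Set.mem_Iic.mpr (Nat.sub_le N i)) (Set.mem_Iic.mpr (Nat.sub_le N j)) h2
  omega

/-- The kernel function is diagonal in the polynomials `P_k(·; λ̄)` and `ξ_{N-k}(·; λ)`. -/
theorem exists_kernel_eq_sum (F : Family) {N : ℕ} {l : Fin 4 → ℂ}
    (he : Set.InjOn (F.e (barParam N l)) (Set.Iic N)) :
    ∃ g : Fin (N + 1) → ℂ, (∀ k, g k ≠ 0) ∧ ∀ x y : ℂ,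
      ∏ p ∈ Finset.range N, (F.η y - F.η (x + I * (((N : ℂ) + 1) / 2 - (p + 1)) * F.γ))
        = ∑ k : Fin (N + 1), g k * (F.P k (barParam N l)).eval (F.η y)
          * (F.ξ (N - k) l).eval (F.η x) := by
  choose c hc hP using fun n => F.exists_isEigenCoeff n (barParam N l)
  choose c' hc' hP' using fun n => F.exists_isEigenCoeff n (twist l)
  set B : ℕ → ℂ := fun k => F.κ * (F.s (k + 1) * F.s (barParam N l 0 + barParam N l 1 + k)
    * F.s (barParam N l 0 + barParam N l 2 + k) * F.s (barParam N l 0 + barParam N l 3 + k)) with hB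
  set B' : ℕ → ℂ := fun k => F.κ * (F.s (k + 1) * F.s (twist l 0 + twist l 1 + k)
    * F.s (twist l 0 + twist l 2 + k) * F.s (twist l 0 + twist l 3 + k)) with hB'
  set L : Matrix (Fin (N + 1)) (Fin (N + 1)) ℂ := Matrix.of fun k m => c k m with hL
  set L' : Matrix (Fin (N + 1)) (Fin (N + 1)) ℂ :=
    Matrix.of fun k m => c' (N - k) (N - m) with hL'
  set T : Matrix (Fin (N + 1)) (Fin (N + 1)) ℂ := Matrix.of fun k m =>
    (if k = m then F.e (barParam N l) m else 0) + if (k : ℕ) = m + 1 then B m else 0 with hT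
  -- The twisted operator with the order of the degrees reversed and its eigenvalue at `N`
  -- subtracted; by the duality its diagonal is that of `T`.
  set T' : Matrix (Fin (N + 1)) (Fin (N + 1)) ℂ := Matrix.of fun k m =>
    (if k = m then F.e (barParam N l) m else 0) + if (k : ℕ) + 1 = m then B' (N - m) else 0 with hT'
  have hdetL : IsUnit L.det := by
    rw [Matrix.det_of_isLowerTriangular L (by
      intro i j hij
      exact (hc i).zero_of_lt j (by simpa using hij)), isUnit_iff_ne_zero]
    exact Finset.prod_ne_zero_iff.mpr fun i _ =>
      (hc i).diag_ne_zero_of_injOn he (Nat.lt_succ_iff.mp i.2)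
  have hdetL' : IsUnit L'.det := by
    rw [Matrix.det_of_isUpperTriangular (by
      intro i j hij
      have hij : (j : ℕ) < i := hij
      exact (hc' (N - i)).zero_of_lt (N - j) (by omega)), isUnit_iff_ne_zero]
    exact Finset.prod_ne_zero_iff.mpr fun i _ =>
      (hc' (N - i)).diag_ne_zero_of_injOn (F.injOn_e_twist he) (Nat.sub_le N i)
  have h1 : L * T = Matrix.diagonal (fun k : Fin (N + 1) => F.e (barParam N l) k) * L := by
    ext n m
    rw [Matrix.diagonal_mul, Matrix.mul_apply]
    simp only [hL, hT, Matrix.of_apply, mul_add, Finset.sum_add_distrib, mul_ite, mul_zero,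
      Finset.sum_ite_eq', Finset.mem_univ, if_true]
    rw [Fin.sum_univ_eq_sum_range (fun k => if k = (m : ℕ) + 1 then c n k * B m else 0) (N + 1),
      Finset.sum_ite_eq', ← (hc n).recursion' m]
    split_ifs with h
    · simp only [hB]
      ring
    · rw [(hc n).zero_of_lt (m + 1) (by simp at h; omega)]
      ring
  have h2 : L' * T' = Matrix.diagonal (fun k : Fin (N + 1) => F.e (barParam N l) k) * L' := by
    ext n m
    rw [Matrix.diagonal_mul, Matrix.mul_apply]
    simp only [hL', hT', Matrix.of_apply, mul_add, Finset.sum_add_distrib, mul_ite, mul_zero,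
      Finset.sum_ite_eq', Finset.mem_univ, if_true]
    have h3 := (hc' (N - n)).recursion' (N - m)
    rw [← F.e_twist_sub N l (Nat.lt_succ_iff.mp n.2), ← F.e_twist_sub N l (Nat.lt_succ_iff.mp m.2),
      Fin.sum_univ_eq_sum_range
        (fun k => if k + 1 = (m : ℕ) then c' (N - n) (N - k) * B' (N - m) else 0) (N + 1)]
    have h4 : ∑ k ∈ Finset.range (N + 1),
        (if k + 1 = (m : ℕ) then c' (N - n) (N - k) * B' (N - m) else 0)
        = c' (N - n) (N - m + 1) * B' (N - m) := by
      obtain hm | ⟨j, hj⟩ : (m : ℕ) = 0 ∨ ∃ j, (m : ℕ) = j + 1 := by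
        rcases h : (m : ℕ) with _ | j
        · exact Or.inl rfl
        · exact Or.inr ⟨j, rfl⟩
      · rw [hm, (hc' (N - n)).zero_of_lt (N - 0 + 1) (by omega)]
        simp
      · rw [hj]
        simp only [Nat.add_right_cancel_iff]
        rw [Finset.sum_ite_eq', if_pos (by simp; omega), show N - (j + 1) + 1 = N - j by omega]
    rw [h4]
    simp only [hB']
    linear_combination h3
  set C : Fin (N + 1) → ℂ := fun k => (-1) ^ (N + (k : ℕ)) * F.sBinom N k with hC
  have hC0 : ∀ k, C k ≠ 0 := fun k =>
    mul_ne_zero (pow_ne_zero _ (by norm_num)) (F.sBinom_ne_zero (Nat.lt_succ_iff.mp k.2))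
  -- Off the diagonal, the ratio of binomials exchanges `s(m+1)` for `s(N-m)`, and the three odd
  -- parameter factors change sign together, which cancels the alternating sign of `C`.
  have h3 : T.transpose * Matrix.diagonal C = Matrix.diagonal C * T' := by
    ext m j
    rw [Matrix.diagonal_mul, Matrix.mul_diagonal]
    simp only [hT, hT', Matrix.transpose_apply, Matrix.of_apply, hC]
    rcases eq_or_ne j m with rfl | hjm
    · simp [mul_comm]
    · rw [if_neg hjm, if_neg hjm.symm]
      by_cases h : (j : ℕ) = m + 1
      · rw [if_pos h, if_pos h.symm, h]
        have hN : (m : ℕ) + 1 ≤ N := by omega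
        have h4 := F.sBinom_succ_mul N m
        simp only [hB, hB', barParam, twist, δ, Pi.sub_apply, Pi.smul_apply, smul_eq_mul]
        rw [Nat.cast_sub hN]
        push_cast
        have h5 : ∀ j : Fin 4, F.s (1 - l 0 + (1 - l j) + (N - ((m : ℕ) + 1)))
            = -F.s (l 0 - ((N : ℂ) + 1) * (1 / 2) + (l j - ((N : ℂ) + 1) * (1 / 2)) + (m : ℕ)) :=
          fun j => by
            rw [← s_neg]
            congr 1
            ring
        rw [h5, h5, h5, show (N : ℂ) - ((m : ℕ) + 1) + 1 = N - (m : ℕ) by ring]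
        generalize F.s (l 0 - ((N : ℂ) + 1) * (1 / 2) + (l 1 - ((N : ℂ) + 1) * (1 / 2)) + (m : ℕ))
          = s1
        generalize F.s (l 0 - ((N : ℂ) + 1) * (1 / 2) + (l 2 - ((N : ℂ) + 1) * (1 / 2)) + (m : ℕ))
          = s2
        generalize F.s (l 0 - ((N : ℂ) + 1) * (1 / 2) + (l 3 - ((N : ℂ) + 1) * (1 / 2)) + (m : ℕ))
          = s3
        linear_combination (-(F.κ * s1 * s2 * s3 * (-1) ^ (N + (m : ℕ)))) * h4
      · rw [if_neg h, if_neg (Ne.symm h)]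
        simp
  have hinj : Function.Injective (fun k : Fin (N + 1) => F.e (barParam N l) k) := fun i j hij =>
    Fin.ext (he (Set.mem_Iic.mpr (Nat.lt_succ_iff.mp i.2))
      (Set.mem_Iic.mpr (Nat.lt_succ_iff.mp j.2)) hij)
  obtain ⟨g, hg, hCg⟩ := exists_diagonal_eq_transpose_mul hdetL hdetL' hC0 hinj h1 h2 h3
  refine ⟨g, hg, fun x y => ?_⟩
  have hγ := F.γ_ne_zero
  obtain ⟨X, rfl⟩ : ∃ X, x = I * F.γ * X := ⟨x / (I * F.γ), by field_simp [I_ne_zero]⟩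
  obtain ⟨Y, rfl⟩ : ∃ Y, y = I * F.γ * Y := ⟨y / (I * F.γ), by field_simp [I_ne_zero]⟩
  -- The free parameter `u = l 0` makes the Newton nodes start at the first entries of `λ̄` in `Y`
  -- and of `𝔱(λ)` in `X`.
  have hK := F.kernel_expansion N (l 0) X Y
  set v : Fin (N + 1) → ℂ := fun k => ((F.newton (barParam N l 0) k).eval (F.ηs Y)) with hv
  set w : Fin (N + 1) → ℂ := fun k => ((F.newton (twist l 0) (N - k)).eval (F.ηs X)) with hw
  have hLv : ∀ i, (L.mulVec v) i = (F.P i (barParam N l)).eval (F.ηs Y) := fun i => by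
    rw [hP, Polynomial.eval_finsetSum]
    simp only [Polynomial.eval_mul, Polynomial.eval_C]
    rw [(hc i).sum_eq (Nat.lt_succ_iff.mp i.2)]
    rfl
  have hLw : ∀ i, (L'.mulVec w) i = (F.ξ (N - i) l).eval (F.ηs X) := fun i => by
    rw [ξ, hP', Polynomial.eval_finsetSum]
    simp only [Polynomial.eval_mul, Polynomial.eval_C]
    rw [(hc' (N - i)).sum_eq (Nat.sub_le N i), ← Equiv.sum_comp Fin.revPerm, Matrix.mulVec, dotProduct]
    refine Finset.sum_congr rfl fun k _ => ?_
    simp only [hL', hw, Matrix.of_apply, Fin.revPerm_apply, Fin.val_rev]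
    rw [show N + 1 - ((k : ℕ) + 1) = N - k by omega]
  calc ∏ p ∈ Finset.range N, (F.η (I * F.γ * Y)
          - F.η (I * F.γ * X + I * (((N : ℂ) + 1) / 2 - (p + 1)) * F.γ))
      = ∏ p ∈ Finset.range N, (F.ηs Y - F.ηs (X + (((N : ℂ) + 1) / 2 - (p + 1)))) := by
        refine Finset.prod_congr rfl fun p _ => ?_
        rw [ηs, ηs]
        congr 2
        ring
    _ = v ⬝ᵥ (Matrix.diagonal C).mulVec w := by
        rw [hK, ← Fin.sum_univ_eq_sum_range (fun k => (-1) ^ (N + k) * F.sBinom N k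
          * (∏ i ∈ Finset.range k, (F.ηs Y - F.ηs (l 0 - ((N : ℂ) + 1) / 2 + i)))
          * ∏ i ∈ Finset.range (N - k), (F.ηs X - F.ηs (1 - l 0 + i))) (N + 1)]
        refine Finset.sum_congr rfl fun k _ => ?_
        simp only [Matrix.mulVec_diagonal, hv, hw, hC, newton, Polynomial.eval_prod,
          Polynomial.eval_sub, Polynomial.eval_X, Polynomial.eval_C, barParam, twist, δ,
          Pi.sub_apply, Pi.smul_apply, smul_eq_mul]
        rw [mul_one_div]
        ring
    _ = L.mulVec v ⬝ᵥ (Matrix.diagonal g).mulVec (L'.mulVec w) := by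
        rw [hCg, ← Matrix.mulVec_mulVec, ← Matrix.mulVec_mulVec, Matrix.dotProduct_mulVec,
          Matrix.vecMul_transpose]
    _ = _ := by
        refine Finset.sum_congr rfl fun k _ => ?_
        rw [Matrix.mulVec_diagonal, hLv, hLw]
        simp only [ηs]
        ring

/-! ### Determinants on consecutive shifts and generic duality -/

/-- The `j`-th of `n` consecutive shifts of `x`, centered at `x`. -/
def node (F : Family) (n : ℕ) (x : ℂ) (j : ℕ) : ℂ := x + I * (((n : ℂ) + 1) / 2 - (j + 1)) * F.γ

/-- The determinant of the values of `n` polynomials at `n` consecutive shifts of `x`. -/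
def evalDet (F : Family) {n : ℕ} (p : Fin n → Polynomial ℂ) (x : ℂ) : ℂ :=
  (Matrix.of fun j k : Fin n => (p k).eval (F.η (F.node n x j))).det

/-- The Vandermonde determinant of the sinusoidal coordinates of `n` consecutive shifts of `x`. -/
def vand (F : Family) (n : ℕ) (x : ℂ) : ℂ :=
  (Matrix.vandermonde fun j : Fin n => F.η (F.node n x j)).det

/-- Polynomials of degrees `0, …, n-1` differ from the monomials by a triangular change of basis,
whose determinant is the product of the leading coefficients. -/
theorem exists_evalDet_eq_mul_vand (F : Family) {n : ℕ} (p : Fin n → Polynomial ℂ)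
    (hp : ∀ i, (p i).degree = (i : ℕ)) :
    ∃ c : ℂ, c ≠ 0 ∧ ∀ x, F.evalDet p x = c * F.vand n x := by
  have hp0 : ∀ i, p i ≠ 0 := fun i h => by simpa [h] using hp i
  have hlc : ∀ i, (p i).leadingCoeff ≠ 0 := fun i => Polynomial.leadingCoeff_ne_zero.mpr (hp0 i)
  refine ⟨∏ i, (p i).leadingCoeff, Finset.prod_ne_zero_iff.mpr fun i _ => hlc i, fun x => ?_⟩
  rw [vand, Matrix.det_eval_matrixOfPolynomials_eq_det_vandermonde _
    (fun i => p i * Polynomial.C (p i).leadingCoeff⁻¹) (fun i => ?_)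
    (fun i => Polynomial.monic_mul_leadingCoeff_inv (hp0 i)), ← Matrix.det_mul_row, evalDet]
  · congr 1
    ext i j
    simp only [Matrix.of_apply, Polynomial.eval_mul, Polynomial.eval_C]
    have := hlc j
    field_simp
  · rw [Polynomial.natDegree_mul_C (inv_ne_zero (hlc i))]
    exact Polynomial.natDegree_eq_of_degree_eq_some (hp i)

theorem degree_newton (F : Family) (c : ℂ) (k : ℕ) : (F.newton c k).degree = k := by
  rw [newton, Polynomial.degree_prod]
  simp

theorem degree_P (F : Family) {N n : ℕ} {l : Fin 4 → ℂ} (he : Set.InjOn (F.e l) (Set.Iic N))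
    (hn : n ≤ N) : (F.P n l).degree = n := by
  obtain ⟨c, hc, hP⟩ := F.exists_isEigenCoeff n l
  have hlast : (Polynomial.C (c n) * F.newton (l 0) n).degree = n := by
    rw [Polynomial.degree_C_mul (hc.diag_ne_zero_of_injOn he hn), degree_newton]
  rw [hP, Finset.sum_range_succ, Polynomial.degree_add_eq_right_of_degree_lt, hlast]
  rw [hlast, ← Polynomial.mem_degreeLT]
  refine Submodule.sum_mem _ fun k hk => Polynomial.mem_degreeLT.mpr ?_
  rw [← Polynomial.smul_eq_C_mul]
  refine (Polynomial.degree_smul_le _ _).trans_lt ?_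
  rw [degree_newton]
  exact_mod_cast Finset.mem_range.mp hk

end Family

theorem card_barD {N M : ℕ} {d : Fin M → ℕ} (hd : Function.Injective d) (hN : ∀ j, d j ≤ N) :
    M + (barD N d).card = N + 1 := by
  have hinj : Function.Injective fun j => N - d j := fun i j h => hd (by
    have h1 := hN i
    have h2 := hN j
    simp only at h
    omega)
  have hsub : (Finset.univ.image fun j => N - d j) ⊆ Finset.range (N + 1) := by
    intro k hk
    obtain ⟨j, _, rfl⟩ := Finset.mem_image.mp hk
    exact Finset.mem_range.mpr (by omega)
  have := Finset.card_sdiff_add_card_eq_card hsub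
  rw [Finset.card_image_of_injective _ hinj, Finset.card_univ, Fintype.card_fin,
    Finset.card_range] at this
  rw [barD]
  omega

/-- The degrees `N - d_j` and the elements of `D̄` together enumerate `0, …, N`. -/
theorem exists_equiv_barD {N M : ℕ} {d : Fin M → ℕ} (hd : Function.Injective d)
    (hN : ∀ j, d j ≤ N) : ∃ σ : Fin M ⊕ Fin (barD N d).card ≃ Fin (N + 1),
      (∀ j, (σ (Sum.inl j) : ℕ) = N - d j) ∧
      ∀ i, (σ (Sum.inr i) : ℕ) = (barD N d).orderEmbOfFin rfl i := by
  have hmem : ∀ i, (barD N d).orderEmbOfFin rfl i ∈ barD N d :=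
    fun i => Finset.orderEmbOfFin_mem _ _ i
  have hlt : ∀ i, (barD N d).orderEmbOfFin rfl i < N + 1 := fun i =>
    Finset.mem_range.mp (Finset.mem_sdiff.mp (hmem i)).1
  have hne : ∀ i j, N - d j ≠ (barD N d).orderEmbOfFin rfl i := fun i j h =>
    (Finset.mem_sdiff.mp (hmem i)).2 (Finset.mem_image.mpr ⟨j, Finset.mem_univ j, h⟩)
  refine ⟨Equiv.ofBijective (Sum.elim (fun j => ⟨N - d j, by omega⟩) fun i => ⟨_, hlt i⟩) ?_,
    fun j => rfl, fun i => rfl⟩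
  rw [Fintype.bijective_iff_injective_and_card]
  refine ⟨?_, by simpa using card_barD hd hN⟩
  rintro (i | i) (j | j) h
  · have h1 := hN i
    have h2 := hN j
    simp only [Sum.elim_inl, Fin.mk.injEq] at h
    rw [hd (show d i = d j by omega)]
  · simp only [Sum.elim_inl, Sum.elim_inr, Fin.mk.injEq] at h
    exact absurd h (hne j i)
  · simp only [Sum.elim_inl, Sum.elim_inr, Fin.mk.injEq] at h
    exact absurd h.symm (hne i j)
  · simp only [Sum.elim_inr, Fin.mk.injEq] at h
    rw [((barD N d).orderEmbOfFin rfl).injective h]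

namespace Family

/-- The duality of the two determinants, up to Vandermonde determinants, for generic parameters. -/
theorem exists_evalDet_duality (F : Family) {N M m : ℕ} {d : Fin M → ℕ} {d' : Fin m → ℕ}
    {l : Fin 4 → ℂ} (he : Set.InjOn (F.e (barParam N l)) (Set.Iic N)) (hN : ∀ j, d j ≤ N)
    (hcard : M + m = N + 1) (σ : Fin M ⊕ Fin m ≃ Fin (N + 1))
    (hσ1 : ∀ j, (σ (Sum.inl j) : ℕ) = N - d j) (hσ2 : ∀ i, (σ (Sum.inr i) : ℕ) = d' i) :
    ∃ c : ℂ, c ≠ 0 ∧ ∀ x, F.evalDet (fun j => F.ξ (d j) l) x * F.vand m x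
        = c * (F.vand M x * F.evalDet (fun j => F.P (d' j) (barParam N l)) x) := by
  -- The reference splitting: it selects the lowest degrees `0, …, M-1` of `ξ` and `0, …, m-1` of
  -- `P`, for which both minors are Vandermonde determinants.
  obtain ⟨τ, hτ1, hτ2⟩ : ∃ τ : Fin M ⊕ Fin m ≃ Fin (N + 1),
      (∀ j, (τ (Sum.inl j) : ℕ) = N - j) ∧ ∀ i, (τ (Sum.inr i) : ℕ) = i := by
    refine ⟨Equiv.ofBijective (Sum.elim (fun j => ⟨N - j, by omega⟩) fun i => ⟨i, by omega⟩) ?_,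
      fun j => rfl, fun i => rfl⟩
    rw [Fintype.bijective_iff_injective_and_card]
    refine ⟨?_, by simpa using hcard⟩
    rintro (i | i) (j | j) h <;>
      simp only [Sum.elim_inl, Sum.elim_inr, Fin.mk.injEq] at h
    · exact congrArg _ (Fin.ext (by omega))
    · omega
    · omega
    · exact congrArg _ (Fin.ext h)
  obtain ⟨g, hg, hK⟩ := F.exists_kernel_eq_sum he
  obtain ⟨cξ, hcξ, hvξ⟩ := F.exists_evalDet_eq_mul_vand (fun j : Fin M => F.ξ j l)
    (fun i => F.degree_P (F.injOn_e_twist he) (by omega))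
  obtain ⟨cP, hcP, hvP⟩ := F.exists_evalDet_eq_mul_vand (fun j : Fin m => F.P j (barParam N l))
    (fun i => F.degree_P he (by omega))
  set sg : ℂ := (Equiv.Perm.sign (σ.trans τ.symm) : ℂ) with hsg
  have hsg2 : sg * sg = 1 := by
    rw [hsg]
    rw [← Int.cast_mul, ← Units.val_mul, Int.units_mul_self, Units.val_one, Int.cast_one]
  have hsg0 : sg ≠ 0 := left_ne_zero_of_mul_eq_one hsg2
  set gσ := ∏ j, g (σ (Sum.inl j)) with hgσ
  set gτ := ∏ j, g (τ (Sum.inl j)) with hgτ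
  have hgσ0 : gσ ≠ 0 := Finset.prod_ne_zero_iff.mpr fun _ _ => hg _
  have hgτ0 : gτ ≠ 0 := Finset.prod_ne_zero_iff.mpr fun _ _ => hg _
  refine ⟨sg * gτ * cξ / (gσ * cP), div_ne_zero (mul_ne_zero (mul_ne_zero hsg0 hgτ0) hcξ)
    (mul_ne_zero hgσ0 hcP), fun x => ?_⟩
  set A : Matrix (Fin M) (Fin (N + 1)) ℂ :=
    Matrix.of fun j k => g k * (F.ξ (N - k) l).eval (F.η (F.node M x j)) with hA
  set B : Matrix (Fin (N + 1)) (Fin m) ℂ :=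
    Matrix.of fun k i => (F.P k (barParam N l)).eval (F.η (F.node m x i)) with hB
  have hAB : A * B = 0 := by
    ext j i
    rw [Matrix.mul_apply, Matrix.zero_apply]
    have := hK (F.node M x j) (F.node m x i)
    -- The index of the kernel factor whose shift of the `j`-th node for `M` is the `i`-th node for
    -- `m`; it stays below `N` exactly because `M + m = N + 1`.
    have hp : M - 1 - (j : ℕ) + i < N := by
      have h1 := j.2
      have h2 := i.2
      omega
    rw [Finset.prod_eq_zero (Finset.mem_range.mpr hp)] at this
    · rw [this]
      refine Finset.sum_congr rfl fun k _ => ?_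
      simp only [hA, hB, Matrix.of_apply]
      ring
    · rw [sub_eq_zero]
      congr 1
      have h1 : (M : ℂ) + m = N + 1 := by exact_mod_cast hcard
      rw [Nat.cast_add, Nat.cast_sub (show (j : ℕ) ≤ M - 1 by omega),
        Nat.cast_sub (show 1 ≤ M by omega)]
      simp only [node]
      push_cast
      linear_combination (I * F.γ / 2) * h1
  have hAσ : (A.submatrix id (σ ∘ Sum.inl)).det = gσ * F.evalDet (fun j => F.ξ (d j) l) x := by
    rw [evalDet, hgσ, ← Matrix.det_mul_row]
    congr 1
    ext i j
    simp only [hA, Matrix.submatrix_apply, Matrix.of_apply, id_eq, Function.comp_apply, hσ1,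
      Nat.sub_sub_self (hN j)]
  have hAτ : (A.submatrix id (τ ∘ Sum.inl)).det = gτ * (cξ * F.vand M x) := by
    rw [← hvξ, evalDet, hgτ, ← Matrix.det_mul_row]
    congr 1
    ext i j
    simp only [hA, Matrix.submatrix_apply, Matrix.of_apply, id_eq, Function.comp_apply, hτ1,
      Nat.sub_sub_self (show (j : ℕ) ≤ N by omega)]
  have hBσ : (B.submatrix (σ ∘ Sum.inr) id).det = F.evalDet (fun j => F.P (d' j) (barParam N l)) x := by
    rw [evalDet, ← Matrix.det_transpose]
    congr 1
    ext i j
    simp only [hB, Matrix.submatrix_apply, Matrix.of_apply, id_eq, Function.comp_apply, hσ2,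
      Matrix.transpose_apply]
  have hBτ : (B.submatrix (τ ∘ Sum.inr) id).det = cP * F.vand m x := by
    rw [← hvP, evalDet, ← Matrix.det_transpose]
    congr 1
    ext i j
    simp only [hB, Matrix.submatrix_apply, Matrix.of_apply, id_eq, Function.comp_apply, hτ2,
      Matrix.transpose_apply]
  have key := det_submatrix_mul_det_submatrix_eq_sign_mul A B hAB σ τ
  rw [hAσ, hAτ, hBσ, hBτ, ← hsg] at key
  rw [div_mul_eq_mul_div, eq_div_iff (mul_ne_zero hgσ0 hcP)]
  linear_combination (-sg) * key
    - (F.evalDet (fun j => F.ξ (d j) l) x * F.vand m x * gσ * cP) * hsg2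

end Family

/-! ### Vandermonde divisibility and the factor `φ_n` -/

/-- A determinant of values of polynomials is divisible by the Vandermonde determinant. -/
theorem det_vandermonde_dvd_det_eval {R : Type*} [CommRing R] {n : ℕ} (v : Fin n → R)
    (f : Fin n → Polynomial R) :
    (Matrix.vandermonde v).det ∣ (Matrix.of fun i j => (f j).eval (v i)).det := by
  induction n with
  | zero => simp
  | succ n ih =>
    -- Subtracting the first row makes each other row divisible by `v i - v 0`. The quotients are
    -- again polynomial values, so the induction applies to the minors along the first row, over any
    -- commutative ring.
    choose g hg using fun j => Polynomial.X_sub_C_dvd_sub_C_eval (a := v 0) (p := f j)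
    have hg' : ∀ i j, (f j).eval (v i) = (v i - v 0) * (g j).eval (v i) + (f j).eval (v 0) := by
      intro i j
      have := congrArg (Polynomial.eval (v i)) (hg j)
      simp only [Polynomial.eval_sub, Polynomial.eval_C, Polynomial.eval_mul,
        Polynomial.eval_X] at this
      linear_combination this
    have hdet : (Matrix.of fun i j => (f j).eval (v i)).det = (Matrix.of (Fin.cases
        (fun j => (f j).eval (v 0)) fun i j => (v i.succ - v 0) * (g j).eval (v i.succ)) :
          Matrix (Fin (n + 1)) (Fin (n + 1)) R).det := by
      refine Matrix.det_eq_of_forall_row_eq_smul_add_const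
        (Fin.cases 0 fun _ => 1) 0 rfl (fun i j => ?_)
      refine Fin.cases ?_ (fun i => ?_) i
      · simp
      · simp only [Matrix.of_apply, Fin.cases_succ, Fin.cases_zero, one_mul]
        exact hg' _ _
    rw [hdet, Matrix.det_succ_row_zero (Matrix.of _)]
    apply Finset.dvd_sum
    intro j _
    apply Dvd.dvd.mul_left
    have hsub : (Matrix.of (Fin.cases (fun j => (f j).eval (v 0)) fun i j =>
        (v i.succ - v 0) * (g j).eval (v i.succ)) : Matrix (Fin (n + 1)) (Fin (n + 1)) R).submatrix
        Fin.succ j.succAbove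
        = Matrix.of fun i k : Fin n => (v i.succ - v 0) *
          (Matrix.of fun i k : Fin n => (g (j.succAbove k)).eval (v i.succ)) i k := by
      ext i k
      rfl
    rw [hsub, Matrix.det_mul_column, Matrix.det_vandermonde, Fin.prod_univ_succ,
      Fin.prod_Ioi_zero]
    refine mul_dvd_mul_left _ ?_
    have := ih (fun i => v i.succ) (fun k => g (j.succAbove k))
    rw [Matrix.det_vandermonde] at this
    simpa only [Fin.prod_Ioi_succ] using this

theorem prod_univ_prod_Ioi_eq {R : Type*} [CommMonoid R] (n : ℕ) (f : ℕ → ℕ → R) :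
    ∏ i : Fin n, ∏ j ∈ Finset.Ioi i, f i j
      = ∏ j ∈ Finset.range n, ∏ i ∈ Finset.range j, f i j := by
  induction n generalizing f with
  | zero => simp
  | succ n ih =>
    rw [Fin.prod_univ_succ, Fin.prod_Ioi_zero, Finset.prod_range_succ']
    simp only [Fin.prod_Ioi_succ, Finset.prod_range_succ', Finset.prod_mul_distrib]
    have := ih fun i j => f (i + 1) (j + 1)
    simp only [Fin.val_succ, Fin.val_zero, Finset.range_zero, Finset.prod_empty, mul_one] at this ⊢
    rw [this, Fin.prod_univ_eq_prod_range (fun j => f 0 (j + 1)) n, mul_comm]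

/-- Among the pairs `i < j < n`, the sum `i + j` takes the values `n - 1 ± k` exactly
`⌊(n - k) / 2⌋` times each. -/
theorem prod_pairs_eq {R : Type*} [CommMonoid R] (g : ℤ → R) (n : ℕ) :
    ∏ j ∈ Finset.range n, ∏ i ∈ Finset.range j, g ((n : ℤ) - 1 - i - j)
      = g 0 ^ (n / 2) * ∏ k ∈ Finset.Icc 1 (n - 2), (g (-k) * g k) ^ ((n - k) / 2) := by
  have hext : ∏ k ∈ Finset.Icc 1 (n - 2), (g (-k) * g k) ^ ((n - k) / 2)
      = ∏ k ∈ Finset.range n, (g (-(k + 1 : ℕ)) * g (k + 1 : ℕ)) ^ ((n - (k + 1)) / 2) := by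
    have hIco : ∏ k ∈ Finset.range n, (g (-(k + 1 : ℕ)) * g (k + 1 : ℕ)) ^ ((n - (k + 1)) / 2)
        = ∏ k ∈ Finset.Ico 1 (n + 1), (g (-k) * g k) ^ ((n - k) / 2) := by
      rw [Finset.prod_Ico_eq_prod_range]
      simp only [Nat.add_sub_cancel, add_comm 1]
    rw [hIco]
    refine Finset.prod_subset (fun k hk => ?_) fun k hk hk' => ?_
    · simp only [Finset.mem_Icc, Finset.mem_Ico] at hk ⊢
      omega
    · simp only [Finset.mem_Icc, Finset.mem_Ico] at hk hk'
      rw [show (n - k) / 2 = 0 by omega, pow_zero]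
  rw [hext]
  clear hext
  induction n using Nat.twoStepInduction with
  | zero => simp
  | one => simp
  | more n ih _ =>
    -- Removing the pairs that involve `0` or `n + 1` leaves the case `n` with indices moved by one.
    -- The removed pairs contribute `g 0` and each `g (±k)`, `1 ≤ k ≤ n`, once, raising every
    -- exponent by one.
    have h1 : ∏ j ∈ Finset.range (n + 1), ∏ i ∈ Finset.range j, g (((n + 2 : ℕ) : ℤ) - 1 - i - j)
        = (∏ k ∈ Finset.range n, g (k + 1 : ℕ))
          * ∏ j ∈ Finset.range n, ∏ i ∈ Finset.range j, g ((n : ℤ) - 1 - i - j) := by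
      rw [Finset.prod_range_succ']
      simp only [Finset.prod_range_succ', Finset.prod_mul_distrib, Finset.range_zero,
        Finset.prod_empty, mul_one]
      rw [mul_comm]
      congr 1
      · rw [← Finset.prod_range_reflect (fun k => g (k + 1 : ℕ)) n]
        refine Finset.prod_congr rfl fun k hk => ?_
        have := Finset.mem_range.mp hk
        congr 1
        omega
      · refine Finset.prod_congr rfl fun j _ => Finset.prod_congr rfl fun i _ => ?_
        congr 1
        push_cast
        ring
    have h2 : ∏ i ∈ Finset.range (n + 1), g (((n + 2 : ℕ) : ℤ) - 1 - i - (n + 1 : ℕ))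
        = (∏ k ∈ Finset.range n, g (-(k + 1 : ℕ))) * g 0 := by
      rw [Finset.prod_range_succ']
      congr 1
      · refine Finset.prod_congr rfl fun i _ => ?_
        congr 1
        push_cast
        ring
      · congr 1
        push_cast
        ring
    have h3 : ∏ k ∈ Finset.range (n + 2),
          (g (-(k + 1 : ℕ)) * g (k + 1 : ℕ)) ^ ((n + 2 - (k + 1)) / 2)
        = ∏ k ∈ Finset.range n, (g (-(k + 1 : ℕ)) * g (k + 1 : ℕ)) ^ ((n - (k + 1)) / 2 + 1) := by
      rw [Finset.prod_range_succ, Finset.prod_range_succ, show (n + 2 - (n + 1)) / 2 = 0 by omega,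
        show (n + 2 - (n + 1 + 1)) / 2 = 0 by omega, pow_zero, pow_zero, mul_one, mul_one]
      refine Finset.prod_congr rfl fun k hk => ?_
      have := Finset.mem_range.mp hk
      rw [show (n + 2 - (k + 1)) / 2 = (n - (k + 1)) / 2 + 1 by omega]
    rw [Finset.prod_range_succ, h1, h2, ih, h3, show (n + 2) / 2 = n / 2 + 1 by omega]
    simp only [pow_succ, Finset.prod_mul_distrib]
    ac_rfl

namespace Family

/-- Separates the midpoint from the difference: on two shifts of `x`, `φ` carries all dependence on
`x` and `s` is a constant. -/
theorem η_sub (F : Family) (y x : ℂ) :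
    F.η y - F.η x = F.κ * F.φ ((y + x) / 2) * F.s ((y - x) / (I * F.γ)) := by
  have hγ := F.γ_ne_zero
  obtain ⟨X, rfl⟩ : ∃ X, x = I * F.γ * X := ⟨x / (I * F.γ), by field_simp [I_ne_zero]⟩
  obtain ⟨Y, rfl⟩ : ∃ Y, y = I * F.γ * Y := ⟨y / (I * F.γ), by field_simp [I_ne_zero]⟩
  have h := F.ηs_sub Y X
  simp only [ηs] at h
  rw [h, show (I * F.γ * Y + I * F.γ * X) / 2 = I * F.γ * ((Y + X) / 2) by ring, φ_I_γ_mul,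
    show (I * F.γ * Y - I * F.γ * X) / (I * F.γ) = Y - X by field_simp [I_ne_zero]]
  congr 3
  ring

/-- The Vandermonde determinant of consecutive shifts is a multiple of `φ_n`. -/
theorem exists_vand_eq (F : Family) (n : ℕ) :
    ∃ c : ℂ, c ≠ 0 ∧ ∀ x, F.vand n x = c * F.phiM n x := by
  refine ⟨∏ i : Fin n, ∏ j ∈ Finset.Ioi i, F.κ * F.s ((i : ℂ) - j), ?_, fun x => ?_⟩
  · refine Finset.prod_ne_zero_iff.mpr fun i _ => Finset.prod_ne_zero_iff.mpr fun j hj =>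
      mul_ne_zero F.κ_ne_zero ?_
    have hij : (i : ℕ) < j := Fin.lt_def.mp (Finset.mem_Ioi.mp hj)
    rw [← neg_sub, s_neg, ← Nat.cast_sub hij.le]
    exact neg_ne_zero.mpr (F.s_natCast_ne_zero (by omega))
  · have hg := prod_pairs_eq (fun k : ℤ => F.φ (x + I * ((k : ℂ) / 2) * F.γ)) n
    rw [← prod_univ_prod_Ioi_eq n
      (fun i j => F.φ (x + I * ((((n : ℤ) - 1 - i - j : ℤ) : ℂ) / 2) * F.γ))] at hg
    have hphi : F.phiM n x = ∏ i : Fin n, ∏ j ∈ Finset.Ioi i,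
        F.φ (x + I * ((((n : ℤ) - 1 - (i : ℕ) - (j : ℕ) : ℤ) : ℂ) / 2) * F.γ) := by
      rw [hg, phiM]
      congr 1
      · simp
      · refine Finset.prod_congr rfl fun k _ => ?_
        congr 3
        push_cast
        ring
    rw [hphi, vand, Matrix.det_vandermonde, ← Finset.prod_mul_distrib]
    refine Finset.prod_congr rfl fun i _ => ?_
    rw [← Finset.prod_mul_distrib]
    refine Finset.prod_congr rfl fun j _ => ?_
    have hγ := F.γ_ne_zero
    rw [η_sub, show (F.node n x j + F.node n x i) / 2
        = x + I * ((((n : ℤ) - 1 - (i : ℕ) - (j : ℕ) : ℤ) : ℂ) / 2) * F.γ by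
          simp only [node]; push_cast; ring,
      show (F.node n x j - F.node n x i) / (I * F.γ) = (i : ℂ) - j by
        rw [div_eq_iff (mul_ne_zero I_ne_zero hγ)]
        simp only [node]
        ring]
    ring

theorem phiM_ne_zero_of_re_mem (F : Family) (n : ℕ) {x : ℂ} (hx : x.re ∈ Set.Ioo (0 : ℝ) 1) :
    F.phiM n x ≠ 0 := by
  obtain ⟨r, _, hr⟩ := F.γ_eq_ofReal
  refine mul_ne_zero (pow_ne_zero _ (F.φ_ne_zero_of_re_mem hx))
    (Finset.prod_ne_zero_iff.mpr fun k _ => pow_ne_zero _ (mul_ne_zero ?_ ?_))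
  all_goals
    refine F.φ_ne_zero_of_re_mem ?_
    rw [hr]
    simpa using hx

/-! ### A shift-invariant function algebra and polynomiality in `η` -/

/-- The polynomial functions of `x`, respectively the Laurent polynomial functions
of `e^{ix}`. -/
def funAlg : Family → Subalgebra ℂ (ℂ → ℂ)
  | W => Algebra.adjoin ℂ {id}
  | AW _ _ _ => Algebra.adjoin ℂ {fun x => exp (I * x), fun x => exp (-(I * x))}

theorem η_comp_add_mem (F : Family) (c : ℂ) : (fun x => F.η (x + c)) ∈ F.funAlg := by
  cases F with
  | W =>
    have h1 : (id : ℂ → ℂ) ∈ W.funAlg := Algebra.subset_adjoin rfl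
    exact pow_mem (add_mem h1 (algebraMap_mem W.funAlg c)) 2
  | AW q h0 h1 =>
    have e1 : (fun x => exp (I * x)) ∈ (AW q h0 h1).funAlg :=
      Algebra.subset_adjoin (Set.mem_insert _ _)
    have e2 : (fun x => exp (-(I * x))) ∈ (AW q h0 h1).funAlg :=
      Algebra.subset_adjoin (Set.mem_insert_of_mem _ rfl)
    have h := add_mem (Subalgebra.smul_mem _ e1 (exp (I * c) / 2))
      (Subalgebra.smul_mem _ e2 (exp (-(I * c)) / 2))
    convert h using 1
    ext x
    simp only [η, cos, Pi.add_apply, Pi.smul_apply, smul_eq_mul]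
    rw [show (x + c) * I = I * x + I * c by ring, show -(x + c) * I = -(I * x) + -(I * c) by ring,
      exp_add, exp_add]
    ring

theorem exists_eval_of_mem_funAlg_W {f : ℂ → ℂ} (hf : f ∈ W.funAlg) :
    ∃ p : Polynomial ℂ, ∀ x, f x = p.eval x := by
  refine Algebra.adjoin_induction (p := fun f _ => ∃ p : Polynomial ℂ, ∀ x, f x = p.eval x)
    ?_ ?_ ?_ ?_ hf
  · rintro _ rfl
    exact ⟨Polynomial.X, by simp⟩
  · intro r
    exact ⟨Polynomial.C r, by simp⟩
  · rintro f g _ _ ⟨p, hp⟩ ⟨r, hr⟩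
    exact ⟨p + r, fun x => by simp [hp, hr]⟩
  · rintro f g _ _ ⟨p, hp⟩ ⟨r, hr⟩
    exact ⟨p * r, fun x => by simp [hp, hr]⟩

theorem exists_eval_of_mem_funAlg_AW {q : ℝ} {h0 : 0 < q} {h1 : q < 1} {f : ℂ → ℂ}
    (hf : f ∈ (AW q h0 h1).funAlg) : ∃ (n : ℕ) (p : Polynomial ℂ),
      ∀ x, f x = exp (-(I * x)) ^ n * p.eval (exp (I * x)) := by
  have he : ∀ x : ℂ, exp (-(I * x)) * exp (I * x) = 1 := fun x => by rw [← exp_add]; simp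
  refine Algebra.adjoin_induction (p := fun f _ => ∃ (n : ℕ) (p : Polynomial ℂ),
      ∀ x, f x = exp (-(I * x)) ^ n * p.eval (exp (I * x))) ?_ ?_ ?_ ?_ hf
  · rintro f hf
    rcases hf with rfl | rfl
    · exact ⟨0, Polynomial.X, by simp⟩
    · exact ⟨1, 1, by simp⟩
  · intro r
    exact ⟨0, Polynomial.C r, by simp⟩
  · rintro f g _ _ ⟨n, p, hp⟩ ⟨m, r, hr⟩
    refine ⟨n + m, p * Polynomial.X ^ m + r * Polynomial.X ^ n, fun x => ?_⟩
    have e1 : ∀ k : ℕ, exp (-(I * x)) ^ k * exp (I * x) ^ k = 1 := fun k => by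
      rw [← mul_pow, he, one_pow]
    simp only [Pi.add_apply, hp, hr, Polynomial.eval_add, Polynomial.eval_mul, Polynomial.eval_pow,
      Polynomial.eval_X, pow_add]
    linear_combination (-(exp (-(I * x)) ^ n * p.eval (exp (I * x)))) * e1 m
      - (exp (-(I * x)) ^ m * r.eval (exp (I * x))) * e1 n
  · rintro f g _ _ ⟨n, p, hp⟩ ⟨m, r, hr⟩
    exact ⟨n + m, p * r, fun x => by simp [hp, hr, pow_add]; ring⟩

/-- A function of `funAlg` with infinitely many zeros on a progression with step `-iγ`
vanishes. -/
theorem eq_zero_of_frequently (F : Family) {f : ℂ → ℂ} (hf : f ∈ F.funAlg) (x₀ : ℂ)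
    (h : ∃ᶠ j : ℕ in Filter.atTop, f (x₀ - I * j * F.γ) = 0) : f = 0 := by
  rw [Nat.frequently_atTop_iff_infinite] at h
  cases F with
  | W =>
    obtain ⟨p, hp⟩ := exists_eval_of_mem_funAlg_W hf
    have hinj : Function.Injective fun j : ℕ => x₀ - I * j * W.γ := fun i j hij => by
      simpa [γ] using hij
    have : p = 0 := Polynomial.eq_zero_of_infinite_isRoot p
      ((h.image hinj.injOn).mono (by
        rintro _ ⟨j, hj, rfl⟩
        exact (hp _).symm.trans hj))
    ext x
    simp [hp, this]
  | AW q h0 h1 =>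
    obtain ⟨n, p, hp⟩ := exists_eval_of_mem_funAlg_AW hf
    have hinj : Function.Injective fun j : ℕ => exp (I * (x₀ - I * j * (AW q h0 h1).γ)) :=
      fun i j hij => by
      have h2 : ∀ k : ℕ, exp (I * (x₀ - I * k * (AW q h0 h1).γ)) = exp (I * x₀) * (q : ℂ) ^ k :=
        fun k => by
        rw [← exp_log_mul_natCast h0, ← exp_add]
        congr 1
        simp only [γ]
        linear_combination (-((k : ℂ) * (Real.log q : ℝ))) * I_sq
      simp only [h2] at hij
      have h3 : (q : ℂ) ^ i = (q : ℂ) ^ j := mul_left_cancel₀ (exp_ne_zero _) hij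
      have h4 : q ^ i = q ^ j := by exact_mod_cast h3
      exact (pow_right_strictAnti₀ h0 h1).injective h4
    have : p = 0 := Polynomial.eq_zero_of_infinite_isRoot p
      ((h.image hinj.injOn).mono (by
        rintro _ ⟨j, hj, rfl⟩
        have hj : f (x₀ - I * j * (AW q h0 h1).γ) = 0 := hj
        rw [hp] at hj
        exact (mul_eq_zero.mp hj).resolve_left (pow_ne_zero _ (exp_ne_zero _))))
    ext x
    simp [hp, this]

/-- The even part of a function of `funAlg` is a polynomial in the sinusoidal coordinate. -/
theorem exists_add_neg_eq_eval (F : Family) {f : ℂ → ℂ} (hf : f ∈ F.funAlg) :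
    ∃ r : Polynomial ℂ, ∀ x, f x + f (-x) = r.eval (F.η x) := by
  cases F with
  | W =>
    obtain ⟨p, hp⟩ := exists_eval_of_mem_funAlg_W hf
    simp only [hp, η]
    clear hp
    induction p using Polynomial.induction_on' with
    | add p r hp hr =>
      obtain ⟨p', hp'⟩ := hp
      obtain ⟨r', hr'⟩ := hr
      refine ⟨p' + r', fun x => ?_⟩
      rw [Polynomial.eval_add, Polynomial.eval_add, Polynomial.eval_add, ← hp', ← hr']
      ring
    | monomial n c =>
      rcases Nat.even_or_odd' n with ⟨m, rfl | rfl⟩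
      · refine ⟨Polynomial.C (2 * c) * Polynomial.X ^ m, fun x => ?_⟩
        simp only [Polynomial.eval_monomial, Polynomial.eval_mul, Polynomial.eval_C,
          Polynomial.eval_pow, Polynomial.eval_X, pow_mul, neg_sq]
        ring
      · refine ⟨0, fun x => ?_⟩
        simp only [Polynomial.eval_monomial, Polynomial.eval_zero, pow_add, pow_mul, neg_sq]
        ring
  | AW q h0 h1 =>
    obtain ⟨n, p, hp⟩ := exists_eval_of_mem_funAlg_AW hf
    simp only [hp, η]
    clear hp
    induction p using Polynomial.induction_on' with
    | add p r hp hr =>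
      obtain ⟨p', hp'⟩ := hp
      obtain ⟨r', hr'⟩ := hr
      refine ⟨p' + r', fun x => ?_⟩
      rw [Polynomial.eval_add, Polynomial.eval_add, Polynomial.eval_add, ← hp', ← hr']
      ring
    | monomial k c =>
      -- The even part comes from `e^{i(k-n)x} + e^{-i(k-n)x} = 2 T_{k-n}(cos x)`; the integer index
      -- also covers `k < n`.
      refine ⟨Polynomial.C (2 * c) * Polynomial.Chebyshev.T ℂ ((k : ℤ) - n), fun x => ?_⟩
      simp only [Polynomial.eval_monomial, Polynomial.eval_mul, Polynomial.eval_C,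
        Polynomial.Chebyshev.T_complex_cos, ← exp_nat_mul]
      rw [cos]
      have e1 : exp (((((k : ℤ) - n : ℤ) : ℂ) * x) * I)
          = exp (n * -(I * x)) * exp (k * (I * x)) := by
        rw [← exp_add]
        congr 1
        push_cast
        ring
      have e2 : exp (-((((k : ℤ) - n : ℤ) : ℂ) * x) * I)
          = exp (n * -(I * -x)) * exp (k * (I * -x)) := by
        rw [← exp_add]
        congr 1
        push_cast
        ring
      rw [e1, e2]
      ring

theorem node_neg (F : Family) (n : ℕ) (x : ℂ) (j : Fin n) :
    F.node n (-x) j = -F.node n x (Fin.rev j) := by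
  simp only [node, Fin.val_rev]
  rw [Nat.cast_sub (by omega)]
  push_cast
  ring

/-- Since `η` is even, reflecting `x` reverses the order of the rows. The Vandermonde determinant
acquires the same sign, so the quotient of the two is even. -/
theorem evalDet_neg (F : Family) {n : ℕ} (p : Fin n → Polynomial ℂ) (x : ℂ) :
    F.evalDet p (-x) = (Equiv.Perm.sign (Fin.revPerm (n := n)) : ℂ) * F.evalDet p x := by
  rw [evalDet, evalDet, ← Matrix.det_permute]
  congr 1
  ext i j
  simp [node_neg, η_neg]

theorem vand_neg (F : Family) (n : ℕ) (x : ℂ) :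
    F.vand n (-x) = (Equiv.Perm.sign (Fin.revPerm (n := n)) : ℂ) * F.vand n x := by
  rw [vand, vand, ← Matrix.det_permute]
  congr 1
  ext i j
  simp [Matrix.vandermonde_apply, node_neg, η_neg]

theorem det_mem_funAlg (F : Family) {n : ℕ} (A : ℂ → Matrix (Fin n) (Fin n) ℂ)
    (hA : ∀ i j, (fun x => A x i j) ∈ F.funAlg) : (fun x => (A x).det) ∈ F.funAlg := by
  have : (fun x => (A x).det) = ∑ σ : Equiv.Perm (Fin n),
      ((Equiv.Perm.sign σ : ℤ) : ℂ) • ∏ i, fun x => A x (σ i) i := by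
    ext x
    rw [Matrix.det_apply']
    simp
  rw [this]
  exact sum_mem fun σ _ => Subalgebra.smul_mem _ (prod_mem fun i _ => hA _ _) _

theorem eval_comp_mem_funAlg (F : Family) (p : Polynomial ℂ) {f : ℂ → ℂ} (hf : f ∈ F.funAlg) :
    (fun x => p.eval (f x)) ∈ F.funAlg := by
  have : (fun x => p.eval (f x)) = Polynomial.aeval f p := by
    ext x
    simp [Polynomial.aeval_fn_apply]
  rw [this]
  have h := Subalgebra.aeval_coe F.funAlg ⟨f, hf⟩ p
  exact h ▸ (Polynomial.aeval (⟨f, hf⟩ : F.funAlg) p).2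

theorem η_node_mem_funAlg (F : Family) (n j : ℕ) : (fun x => F.η (F.node n x j)) ∈ F.funAlg :=
  F.η_comp_add_mem _

/-- The determinant of the values of arbitrary polynomials in the sinusoidal coordinate is `φ_n`
times such a polynomial. -/
theorem exists_evalDet_eq_phiM_mul (F : Family) {n : ℕ} (p : Fin n → Polynomial ℂ) :
    ∃ Ξ : Polynomial ℂ, ∀ x, F.evalDet p x = F.phiM n x * Ξ.eval (F.η x) := by
  -- The nodes are taken as elements of the function algebra, so the divisibility yields a quotient
  -- in that algebra, defined also at zeros of the Vandermonde determinant.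
  set v : Fin n → F.funAlg := fun j => ⟨_, F.η_node_mem_funAlg n j⟩ with hv
  obtain ⟨w, hw⟩ := det_vandermonde_dvd_det_eval v fun k => (p k).map (algebraMap ℂ F.funAlg)
  have hdvd : ∀ x, F.evalDet p x = F.vand n x * (w : ℂ → ℂ) x := fun x => by
    set ev : F.funAlg →ₐ[ℂ] ℂ :=
      (Pi.evalAlgHom ℂ (fun _ : ℂ => ℂ) x).comp F.funAlg.val with hev
    have h := congrArg ev hw
    rw [map_mul, AlgHom.map_det, AlgHom.map_det] at h
    have h1 : ev.mapMatrix (Matrix.vandermonde v)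
        = Matrix.vandermonde fun j : Fin n => F.η (F.node n x j) := by
      ext i j
      simp [Matrix.vandermonde_apply, hv, hev]
    have h2 : ev.mapMatrix (Matrix.of fun i j =>
          ((p j).map (algebraMap ℂ F.funAlg)).eval (v i))
        = Matrix.of fun i j : Fin n => (p j).eval (F.η (F.node n x i)) := by
      ext i j
      simp only [AlgHom.mapMatrix_apply, Matrix.map_apply, Matrix.of_apply]
      rw [Polynomial.eval_map_algebraMap, ← Polynomial.aeval_algHom_apply]
      rfl
    rw [h1, h2] at h
    exact h
  obtain ⟨r, hr⟩ := F.exists_add_neg_eq_eval w.2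
  obtain ⟨c, hc, hcv⟩ := F.exists_vand_eq n
  refine ⟨Polynomial.C (c / 2) * r, fun x => ?_⟩
  have hsg : ((Equiv.Perm.sign (Fin.revPerm (n := n)) : ℤ) : ℂ) ≠ 0 := by simp
  -- Evenness of `w` is needed only after multiplication by `vand`; replacing `w` by its even part
  -- then keeps the factorization valid at every `x`.
  have heven : ∀ x, F.vand n x * ((w : ℂ → ℂ) x - (w : ℂ → ℂ) (-x)) = 0 := fun x => by
    have h := hdvd (-x)
    rw [evalDet_neg, vand_neg, hdvd x, mul_assoc] at h
    linear_combination mul_left_cancel₀ hsg h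
  simp only [Polynomial.eval_mul, Polynomial.eval_C]
  rw [← hr]
  linear_combination hdvd x + (1 / 2) * heven x
    + (1 / 2 * ((w : ℂ → ℂ) x + (w : ℂ → ℂ) (-x))) * hcv x

/-! ### Casorati's criterion for linear independence -/

/-- A polynomial is determined by its values at `η(x)` for real `x` between `0` and `1`. -/
theorem eq_of_eval_η_eq (F : Family) {p r : Polynomial ℂ}
    (h : ∀ x : ℝ, x ∈ Set.Ioo (0 : ℝ) 1 → p.eval (F.η x) = r.eval (F.η x)) : p = r := by
  refine Polynomial.eq_of_infinite_eval_eq p r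
    (((Set.Ioo_infinite one_pos).image F.injOn_η_ofReal).mono ?_)
  rintro _ ⟨x, hx, rfl⟩
  exact h x hx

/-- The Casorati determinant of linearly independent polynomials in the sinusoidal coordinate does
not vanish identically. -/
theorem exists_det_eval_ne_zero (F : Family) {n : ℕ} (p : Fin n → Polynomial ℂ)
    (hp : LinearIndependent ℂ p) :
    ∃ x, (Matrix.of fun i k : Fin n => (p k).eval (F.η (x - I * (i : ℕ) * F.γ))).det ≠ 0 := by
  induction n with
  | zero => simp
  | succ n ih =>
    by_contra! hD
    set A : ℂ → Matrix (Fin (n + 1)) (Fin (n + 1)) ℂ := fun x =>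
      Matrix.of fun i k => (p k).eval (F.η (x - I * (i : ℕ) * F.γ)) with hA
    -- If the determinant vanishes identically, the cofactors along the last row give a kernel
    -- vector at each `x`. Kernel vectors at `x` and `x - iγ` share `n` equations, so they are
    -- proportional where the last cofactor is non-zero at `x - iγ`.
    set C : Fin (n + 1) → ℂ → ℂ := fun k x => (A x).adjugate k (Fin.last n) with hC
    have hAC : ∀ x (i : Fin (n + 1)),
        ∑ k, (p k).eval (F.η (x - I * (i : ℕ) * F.γ)) * C k x = 0 := fun x i => by
      have h := congrFun (congrFun (Matrix.mul_adjugate (A x)) i) (Fin.last n)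
      rw [show (A x).det = 0 from hD x, zero_smul, Matrix.mul_apply] at h
      exact h
    have hClast : ∀ x, C (Fin.last n) x = (Matrix.of fun i k : Fin n =>
        (p k.castSucc).eval (F.η (x - I * (i : ℕ) * F.γ))).det := fun x => by
      simp only [hC]
      rw [Matrix.adjugate_fin_succ_eq_det_submatrix, Fin.succAbove_last, ← two_mul, pow_mul,
        neg_one_sq, one_pow, one_mul]
      rfl
    have hmem : C (Fin.last n) ∈ F.funAlg := by
      rw [show C (Fin.last n) = _ from funext hClast]
      refine F.det_mem_funAlg _ fun i k => F.eval_comp_mem_funAlg _ ?_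
      simpa only [sub_eq_add_neg] using F.η_comp_add_mem (-(I * (i : ℕ) * F.γ))
    have hstep : ∀ x, C (Fin.last n) (x - I * F.γ) ≠ 0 → ∀ k,
        C k x * C (Fin.last n) (x - I * F.γ) = C (Fin.last n) x * C k (x - I * F.γ) := by
      intro x hx
      set u : Fin (n + 1) → ℂ := fun k =>
        C (Fin.last n) (x - I * F.γ) * C k x - C (Fin.last n) x * C k (x - I * F.γ) with hu
      have hulast : u (Fin.last n) = 0 := by
        simp only [hu]
        ring
      have hrow : ∀ i : Fin n,
          ∑ k, (p k).eval (F.η (x - I * F.γ - I * (i : ℕ) * F.γ)) * u k = 0 := fun i => by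
        have e1 := hAC x i.succ
        have e2 := hAC (x - I * F.γ) i.castSucc
        rw [Fin.val_succ, show x - I * ((i : ℕ) + 1 : ℕ) * F.γ
          = x - I * F.γ - I * (i : ℕ) * F.γ by push_cast; ring] at e1
        rw [Fin.val_castSucc] at e2
        simp only [hu, mul_sub, Finset.sum_sub_distrib, mul_left_comm _ (C (Fin.last n) _),
          ← Finset.mul_sum]
        rw [e1, e2]
        ring
      rw [hClast] at hx
      have hzero := Matrix.eq_zero_of_mulVec_eq_zero hx (v := fun k => u k.castSucc) (by
        ext i
        have := hrow i
        rw [Fin.sum_univ_castSucc, hulast, mul_zero, add_zero] at this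
        exact this)
      intro k
      have : u k = 0 := by
        refine Fin.lastCases hulast (fun k => congrFun hzero k) k
      simp only [hu] at this
      linear_combination this
    obtain ⟨x₁, hx₁⟩ := ih (fun k => p k.castSucc)
      (hp.comp _ (Fin.castSucc_injective n))
    -- The last cofactor is the determinant of size `n`, not identically zero by induction, so it
    -- has only finitely many zeros on the progression. Beyond them the ratios `h` are constant and
    -- give a linear relation at infinitely many points, with last coefficient `1`.
    have hev : ∀ᶠ j : ℕ in Filter.atTop, C (Fin.last n) (x₁ - I * j * F.γ) ≠ 0 := by
      by_contra h
      rw [Filter.not_eventually] at h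
      simp only [not_not] at h
      have := F.eq_zero_of_frequently hmem x₁ h
      rw [← hClast, this] at hx₁
      exact hx₁ rfl
    obtain ⟨J, hJ⟩ := Filter.eventually_atTop.mp hev
    set x₀ := x₁ - I * J * F.γ with hx₀
    have hne : ∀ j : ℕ, C (Fin.last n) (x₀ - I * j * F.γ) ≠ 0 := fun j => by
      have := hJ (J + j) (Nat.le_add_right J j)
      rwa [show x₁ - I * ((J + j : ℕ) : ℂ) * F.γ = x₀ - I * j * F.γ by
        rw [hx₀]; push_cast; ring] at this
    have hne0 : C (Fin.last n) x₀ ≠ 0 := by simpa using hne 0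
    set h : Fin (n + 1) → ℂ := fun k => C k x₀ / C (Fin.last n) x₀ with hh
    have hprop : ∀ (j : ℕ) k,
        C k (x₀ - I * j * F.γ) = h k * C (Fin.last n) (x₀ - I * j * F.γ) := by
      intro j
      induction j with
      | zero =>
        intro k
        simp only [hh, Nat.cast_zero, mul_zero, zero_mul, sub_zero]
        rw [div_mul_cancel₀ _ hne0]
      | succ j ihj =>
        intro k
        have e : x₀ - I * (j + 1 : ℕ) * F.γ = x₀ - I * j * F.γ - I * F.γ := by push_cast; ring
        have h2 := hne (j + 1)
        have h3 := hne j
        rw [e] at h2 ⊢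
        have h4 := hstep _ h2 k
        rw [ihj k] at h4
        apply mul_left_cancel₀ h3
        linear_combination -h4
    have hsum : ∀ x, (∑ k, Polynomial.C (h k) * p k).eval (F.η x)
        = ∑ k, h k * (p k).eval (F.η x) := fun x => by
      simp only [Polynomial.eval_finsetSum, Polynomial.eval_mul, Polynomial.eval_C]
    have hroot : ∀ j : ℕ, (∑ k, Polynomial.C (h k) * p k).eval (F.η (x₀ - I * j * F.γ)) = 0 := by
      intro j
      have e := hAC (x₀ - I * j * F.γ) 0
      simp only [Fin.val_zero, Nat.cast_zero, mul_zero, zero_mul, sub_zero] at e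
      apply mul_right_cancel₀ (hne j)
      rw [hsum, Finset.sum_mul, zero_mul, ← e]
      exact Finset.sum_congr rfl fun k _ => by rw [hprop j k]; ring
    have hfun := F.eq_zero_of_frequently
      (F.eval_comp_mem_funAlg (∑ k, Polynomial.C (h k) * p k)
        (by simpa using F.η_comp_add_mem 0)) x₀
      (Filter.Eventually.of_forall hroot).frequently
    have hpoly : ∑ k, h k • p k = 0 := by
      simp only [Polynomial.smul_eq_C_mul]
      refine F.eq_of_eval_η_eq fun x _ => ?_
      rw [Polynomial.eval_zero]
      exact congrFun hfun x
    have := Fintype.linearIndependent_iff.mp hp h hpoly (Fin.last n)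
    simp only [hh, div_self hne0, one_ne_zero] at this

theorem exists_evalDet_ne_zero (F : Family) {n : ℕ} (p : Fin n → Polynomial ℂ)
    (hp : LinearIndependent ℂ p) : ∃ x, F.evalDet p x ≠ 0 := by
  obtain ⟨x, hx⟩ := F.exists_det_eval_ne_zero p hp
  refine ⟨x - I * (((n : ℂ) + 1) / 2 - 1) * F.γ, ?_⟩
  rw [evalDet]
  convert hx using 2
  ext i k
  simp only [node, Matrix.of_apply]
  congr 2
  ring

theorem linearIndependent_of_degree_injective {n : ℕ} {p : Fin n → Polynomial ℂ} {f : Fin n → ℕ}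
    (hp : ∀ i, (p i).degree = f i) (hf : Function.Injective f) : LinearIndependent ℂ p := by
  rw [Fintype.linearIndependent_iff]
  intro h hsum i
  have hdeg : ∀ i, h i ≠ 0 → (h i • p i).degree = f i := fun i hi => by
    rw [Polynomial.smul_eq_C_mul, Polynomial.degree_C_mul hi, hp]
  have hne : ∀ i, h i • p i ≠ 0 → h i ≠ 0 := fun i hi h0 => hi (by rw [h0, zero_smul])
  have hsup := Polynomial.degree_sum_eq_of_disjoint (fun i => h i • p i) Finset.univ (by
    intro i hi j hj hij
    simp only [Function.onFun, Function.comp_apply]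
    rw [hdeg i (hne i hi.2), hdeg j (hne j hj.2)]
    exact_mod_cast hf.ne hij)
  rw [hsum, Polynomial.degree_zero] at hsup
  by_contra hi
  have := Finset.le_sup (f := fun i => (h i • p i).degree) (Finset.mem_univ i)
  rw [← hsup, hdeg i hi, le_bot_iff] at this
  exact WithBot.coe_ne_bot this

/-! ### Exceptional parameters by continuity -/

theorem continuous_eval_P (F : Family) (n : ℕ) (z : ℂ) {T : Type*} [TopologicalSpace T]
    {L : T → Fin 4 → ℂ} (hL : Continuous L) : Continuous fun t => (F.P n (L t)).eval z := by
  have hLj : ∀ j, Continuous fun t => L t j := fun j => (continuous_apply j).comp hL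
  cases F with
  | W =>
    simp only [P, wilson, a, Polynomial.eval_finsetSum, Polynomial.eval_mul, Polynomial.eval_C,
      Polynomial.eval_prod, Polynomial.eval_add, Polynomial.eval_X, poch_eq_prod]
    fun_prop
  | AW q h0 h1 =>
    simp only [P, askeyWilson, a, Polynomial.eval_finsetSum, Polynomial.eval_mul,
      Polynomial.eval_C, Polynomial.eval_prod, Polynomial.eval_add, Polynomial.eval_sub,
      Polynomial.eval_one, Polynomial.eval_X, qPoch, ofReal_cpow_eq_exp h0, ← exp_nat_mul,
      ← exp_neg]
    fun_prop

theorem continuous_evalDet (F : Family) {n : ℕ} (f : Fin n → ℕ) (x : ℂ) {T : Type*}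
    [TopologicalSpace T] {L : T → Fin 4 → ℂ} (hL : Continuous L) :
    Continuous fun t => F.evalDet (fun j => F.P (f j) (L t)) x :=
  Continuous.matrix_det (continuous_matrix fun _ _ => F.continuous_eval_P _ _ hL)

/-- The line through `l` in the direction of the first parameter. -/
def shiftFirst (l : Fin 4 → ℂ) (t : ℝ) : Fin 4 → ℂ := Function.update l 0 (l 0 + t)

theorem continuous_shiftFirst (l : Fin 4 → ℂ) : Continuous (shiftFirst l) := by
  unfold shiftFirst
  fun_prop

theorem shiftFirst_zero (l : Fin 4 → ℂ) : shiftFirst l 0 = l := by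
  simp [shiftFirst]

theorem parSum_shiftFirst (l : Fin 4 → ℂ) (t : ℝ) : parSum (shiftFirst l t) = parSum l + t := by
  simp only [parSum, shiftFirst, Function.update_self, ne_eq, Fin.reduceEq, not_false_eq_true,
    Function.update_of_ne]
  ring

open Topology in
theorem eventually_injOn_e (F : Family) (N : ℕ) (l : Fin 4 → ℂ) :
    ∀ᶠ t in 𝓝[≠] (0 : ℝ), Set.InjOn (F.e (barParam N (shiftFirst l t))) (Set.Iic N) := by
  have hne : ∀ c : ℝ, ∀ᶠ t in 𝓝[≠] (0 : ℝ), t ≠ c := fun c => by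
    rcases eq_or_ne c 0 with rfl | hc
    · exact self_mem_nhdsWithin
    · exact (eventually_ne_nhds hc.symm).filter_mono nhdsWithin_le_nhds
  -- A coincidence of eigenvalues with distinct indices makes `n + k + b₁(λ̄) - 1` a zero of `s`,
  -- where `b₁(λ̄)` is the parameter sum; its vanishing real part excludes one real `t` for each
  -- pair.
  have hall : ∀ᶠ t in 𝓝[≠] (0 : ℝ), ∀ n ∈ Set.Iic N, ∀ k ∈ Set.Iic N,
      t ≠ 1 - n - k - (parSum l).re + 2 * (N + 1) :=
    (Filter.eventually_all_finite (Set.finite_Iic N)).mpr fun n _ =>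
      (Filter.eventually_all_finite (Set.finite_Iic N)).mpr fun k _ => hne _
  filter_upwards [hall] with t ht n hn k hk hnk
  by_contra hne
  have h := sub_eq_zero.mpr hnk
  rw [e_sub, mul_eq_zero] at h
  rcases h with h | h
  · have := F.re_eq_zero_of_s_eq_zero h
    simp only [sub_re, natCast_re, sub_eq_zero, Nat.cast_inj] at this
    exact hne this
  · have := F.re_eq_zero_of_s_eq_zero h
    rw [parSum_barParam, parSum_shiftFirst] at this
    refine ht n hn k hk ?_
    simp only [sub_re, add_re, natCast_re, ofReal_re, mul_re, re_ofNat, im_ofNat, one_re, add_im,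
      natCast_im, one_im] at this
    linarith

/-- The proportionality of the two determinants, up to Vandermonde determinants, for all
parameters. -/
theorem evalDet_mul_evalDet_symm (F : Family) {N M m : ℕ} {d : Fin M → ℕ} {d' : Fin m → ℕ}
    (l : Fin 4 → ℂ) (hN : ∀ j, d j ≤ N)
    (hcard : M + m = N + 1) (σ : Fin M ⊕ Fin m ≃ Fin (N + 1))
    (hσ1 : ∀ j, (σ (Sum.inl j) : ℕ) = N - d j) (hσ2 : ∀ i, (σ (Sum.inr i) : ℕ) = d' i)
    (x y : ℂ) :
    F.evalDet (fun j => F.ξ (d j) l) x * F.vand m x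
        * (F.vand M y * F.evalDet (fun j => F.P (d' j) (barParam N l)) y)
      = F.evalDet (fun j => F.ξ (d j) l) y * F.vand m y
        * (F.vand M x * F.evalDet (fun j => F.P (d' j) (barParam N l)) x) := by
  have hL := continuous_shiftFirst l
  have hbar : Continuous fun t => barParam N (shiftFirst l t) := by
    unfold barParam
    fun_prop
  have htwist : Continuous fun t => twist (shiftFirst l t) := by
    unfold twist
    fun_prop
  have hcont : ∀ x y, Continuous fun t : ℝ =>
      F.evalDet (fun j => F.ξ (d j) (shiftFirst l t)) x * F.vand m x
        * (F.vand M y * F.evalDet (fun j => F.P (d' j) (barParam N (shiftFirst l t))) y) :=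
    fun x y => ((F.continuous_evalDet d x htwist).mul continuous_const).mul
      (continuous_const.mul (F.continuous_evalDet d' y hbar))
  -- The constant of proportionality depends on `t` and need not have a usable limit; the
  -- cross-multiplied identity in `x` and `y` no longer contains it.
  have hlim := tendsto_nhds_unique_of_eventuallyEq
    (((hcont x y).tendsto 0).mono_left nhdsWithin_le_nhds)
    (((hcont y x).tendsto 0).mono_left (nhdsWithin_le_nhds (s := {0}ᶜ))) (by
      filter_upwards [F.eventually_injOn_e N l] with t ht
      obtain ⟨c, _, h⟩ := F.exists_evalDet_duality ht hN hcard σ hσ1 hσ2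
      rw [h x, h y]
      ring)
  simpa only [shiftFirst_zero] using hlim

/-! ### Assembly of the theorem -/

/-- The identity for the Casoratians of two complementary sets of degrees, in terms of an
enumeration `σ` of `0, …, N` by the two sets. -/
theorem exists_casoratian_eq_and_proportional (F : Family) {N M m : ℕ} {d : Fin M → ℕ}
    {d' : Fin m → ℕ} (l : Fin 4 → ℂ) (hN : ∀ j, d j ≤ N) (hd' : Function.Injective d')
    (hcard : M + m = N + 1) (σ : Fin M ⊕ Fin m ≃ Fin (N + 1))
    (hσ1 : ∀ j, (σ (Sum.inl j) : ℕ) = N - d j) (hσ2 : ∀ i, (σ (Sum.inr i) : ℕ) = d' i)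
    (tw ei : ℂ → ℂ)
    (htw : ∀ x, tw x = I ^ (M * (M - 1) / 2) * F.evalDet (fun j => F.ξ (d j) l) x)
    (hei : ∀ x, ei x = I ^ (m * (m - 1) / 2)
      * F.evalDet (fun j => F.P (d' j) (barParam N l)) x) :
    ∃ Ξ Ξbar : Polynomial ℂ,
      (∀ x : ℂ, tw x = F.phiM M x * Ξ.eval (F.η x)) ∧
      (∀ x : ℂ, ei x = F.phiM m x * Ξbar.eval (F.η x)) ∧
      (∃ c c' : ℂ, (c ≠ 0 ∨ c' ≠ 0) ∧ Polynomial.C c * Ξ = Polynomial.C c' * Ξbar) ∧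
      (Set.InjOn (fun n : ℕ => F.E n (barParam N l)) (Set.Iic N) →
        Ξ ≠ 0 ∧ Ξbar ≠ 0 ∧
        ∃ c : ℂ, c ≠ 0 ∧ Ξ = Polynomial.C c * Ξbar ∧
          ∀ x : ℂ, F.phiM M x ≠ 0 → F.phiM m x ≠ 0 →
            (F.phiM M x)⁻¹ * tw x = c * ((F.phiM m x)⁻¹ * ei x)) := by
  obtain ⟨Ξ, hΞ⟩ := F.exists_evalDet_eq_phiM_mul fun j => F.ξ (d j) l
  obtain ⟨Ξb, hΞb⟩ := F.exists_evalDet_eq_phiM_mul fun j => F.P (d' j) (barParam N l)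
  set iM : ℂ := I ^ (M * (M - 1) / 2) with hiM
  set iₘ : ℂ := I ^ (m * (m - 1) / 2) with him
  have hiM0 : iM ≠ 0 := pow_ne_zero _ I_ne_zero
  have him0 : iₘ ≠ 0 := pow_ne_zero _ I_ne_zero
  obtain ⟨cM, hcM, hvM⟩ := F.exists_vand_eq M
  obtain ⟨cm, hcm, hvm⟩ := F.exists_vand_eq m
  have htwΞ : ∀ x, tw x = F.phiM M x * (Polynomial.C iM * Ξ).eval (F.η x) := fun x => by
    rw [htw, hΞ, Polynomial.eval_mul, Polynomial.eval_C]
    ring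
  have heiΞ : ∀ x, ei x = F.phiM m x * (Polynomial.C iₘ * Ξb).eval (F.η x) := fun x => by
    rw [hei, hΞb, Polynomial.eval_mul, Polynomial.eval_C]
    ring
  refine ⟨Polynomial.C iM * Ξ, Polynomial.C iₘ * Ξb, htwΞ, heiΞ, ?_, fun hE => ?_⟩
  · have hsymm : ∀ x y : ℝ, x ∈ Set.Ioo (0 : ℝ) 1 → y ∈ Set.Ioo (0 : ℝ) 1 →
        Ξ.eval (F.η x) * Ξb.eval (F.η y) = Ξ.eval (F.η y) * Ξb.eval (F.η x) := by
      intro x y hx hy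
      have h := F.evalDet_mul_evalDet_symm l hN hcard σ hσ1 hσ2 x y
      rw [hΞ, hΞ, hΞb, hΞb, hvM, hvM, hvm, hvm] at h
      have hφ : ∀ n, F.phiM n x ≠ 0 ∧ F.phiM n y ≠ 0 := fun n =>
        ⟨F.phiM_ne_zero_of_re_mem n (by simpa using hx),
          F.phiM_ne_zero_of_re_mem n (by simpa using hy)⟩
      have hprod : cM * cm * (F.phiM M x * F.phiM M y * (F.phiM m x * F.phiM m y)) ≠ 0 :=
        mul_ne_zero (mul_ne_zero hcM hcm) (mul_ne_zero (mul_ne_zero (hφ M).1 (hφ M).2)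
          (mul_ne_zero (hφ m).1 (hφ m).2))
      apply mul_left_cancel₀ hprod
      linear_combination h
    -- If `Ξb` vanishes, the dependence is trivial; otherwise `y` is frozen at a point where `Ξb` is
    -- non-zero, and the symmetric identity becomes a linear relation in `x`.
    by_cases h0 : Ξb = 0
    · exact ⟨0, 1, Or.inr one_ne_zero, by simp [h0]⟩
    · obtain ⟨y, hy, hy0⟩ : ∃ y : ℝ, y ∈ Set.Ioo (0 : ℝ) 1 ∧ Ξb.eval (F.η y) ≠ 0 := by
        by_contra! h
        exact h0 (F.eq_of_eval_η_eq fun y hy => by rw [h y hy, Polynomial.eval_zero])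
      refine ⟨iₘ * Ξb.eval (F.η y), iM * Ξ.eval (F.η y), Or.inl (mul_ne_zero him0 hy0),
        F.eq_of_eval_η_eq fun x hx => ?_⟩
      simp only [Polynomial.eval_mul, Polynomial.eval_C]
      linear_combination iM * iₘ * hsymm x y hx hy
  · have he := (F.injOn_e_iff (barParam N l) N).mpr hE
    obtain ⟨c, hc, hdual⟩ := F.exists_evalDet_duality he hN hcard σ hσ1 hσ2
    have hprop : Polynomial.C iM * Ξ
        = Polynomial.C (c * cM * iM / (cm * iₘ)) * (Polynomial.C iₘ * Ξb) := by
      refine F.eq_of_eval_η_eq fun x hx => ?_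
      have hφ : ∀ n, F.phiM n x ≠ 0 := fun n =>
        F.phiM_ne_zero_of_re_mem n (by simpa using hx)
      have h := hdual x
      rw [hΞ, hΞb, hvM, hvm] at h
      simp only [Polynomial.eval_mul, Polynomial.eval_C]
      apply mul_left_cancel₀ (mul_ne_zero (mul_ne_zero (hφ M) (hφ m)) hcm)
      field_simp
      linear_combination h
    have hc0 : c * cM * iM / (cm * iₘ) ≠ 0 :=
      div_ne_zero (mul_ne_zero (mul_ne_zero hc hcM) hiM0) (mul_ne_zero hcm him0)
    have hΞb0 : Polynomial.C iₘ * Ξb ≠ 0 := by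
      have hle : ∀ i, d' i ≤ N := fun i => by
        have := (σ (Sum.inr i)).2
        rw [hσ2 i] at this
        exact Nat.lt_succ_iff.mp this
      -- Distinct eigenvalues give `P_n` exact degree `n`, so polynomials of distinct degrees are
      -- independent and Casorati's criterion applies. Non-vanishing of the other polynomial then
      -- follows from proportionality.
      obtain ⟨x, hx⟩ := F.exists_evalDet_ne_zero (fun j => F.P (d' j) (barParam N l))
        (linearIndependent_of_degree_injective (fun i => F.degree_P he (hle i))
          hd')
      intro h0
      have := heiΞ x
      rw [h0, Polynomial.eval_zero, mul_zero, hei] at this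
      exact hx ((mul_eq_zero.mp this).resolve_left him0)
    refine ⟨?_, hΞb0, _, hc0, hprop, fun x hx hx' => ?_⟩
    · rw [hprop]
      exact mul_ne_zero (Polynomial.C_ne_zero.mpr hc0) hΞb0
    · rw [htwΞ, heiΞ, inv_mul_cancel_left₀ hx, inv_mul_cancel_left₀ hx', hprop,
        Polynomial.eval_mul, Polynomial.eval_C]

end Family

end CasoratianIdentities

end

theorem proposition2 (F : CasoratianIdentities.Family) (N M : ℕ) (d : Fin M → ℕ)
    (hd : Function.Injective d) (hN : ∀ j, d j ≤ N) (l : Fin 4 → ℂ) :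
    ∃ Ξ Ξbar : Polynomial ℂ,
      (∀ x : ℂ, F.twistedCasoratian d l x = F.phiM M x * Ξ.eval (F.η x)) ∧
      (∀ x : ℂ, F.eigenCasoratian (CasoratianIdentities.barD N d)
          (CasoratianIdentities.barParam N l) x
        = F.phiM (N + 1 - M) x * Ξbar.eval (F.η x)) ∧
      (∃ c c' : ℂ, (c ≠ 0 ∨ c' ≠ 0) ∧ Polynomial.C c * Ξ = Polynomial.C c' * Ξbar) ∧
      (Set.InjOn (fun n : ℕ => F.E n (CasoratianIdentities.barParam N l)) (Set.Iic N) →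
        Ξ ≠ 0 ∧ Ξbar ≠ 0 ∧
        ∃ c : ℂ, c ≠ 0 ∧ Ξ = Polynomial.C c * Ξbar ∧
          ∀ x : ℂ, F.phiM M x ≠ 0 → F.phiM (N + 1 - M) x ≠ 0 →
            (F.phiM M x)⁻¹ * F.twistedCasoratian d l x =
              c * ((F.phiM (N + 1 - M) x)⁻¹ *
                F.eigenCasoratian (CasoratianIdentities.barD N d)
                  (CasoratianIdentities.barParam N l) x)) := by
  obtain ⟨σ, hσ1, hσ2⟩ := CasoratianIdentities.exists_equiv_barD hd hN
  have hcard := CasoratianIdentities.card_barD hd hN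
  have hm : N + 1 - M = (CasoratianIdentities.barD N d).card := by omega
  rw [hm]
  exact F.exists_casoratian_eq_and_proportional l hN
    ((CasoratianIdentities.barD N d).orderEmbOfFin rfl).injective hcard σ hσ1 hσ2 _ _ (fun _ => rfl) (fun _ => rfl)
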